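/- **Setting.** Let $C_u\ge 1$ be an integer and $k\ge 0$ (so each output row has $m=k+1\ge 1$ columns). Records are triples (user, group, other information); the groups are indexed by a finite or countably infinite set $I$. A dataset is a finite set $X$ of records in which every user has at most one record per group and at most $C_u$ records in total. Two datasets are neighbors if one is obtained from the other by adding the records of one user. Write $X\cap G_i$ for the records of $X$ in group $i$ and $C(X,G_i)=|X\cap G_i|$. An aggregation function $A$ assigns to every group $i$ and every finite set $X\cap G_i$ of records a vector $A(X,G_i)\in\mathbb R^{k}$ (absent if $k=0$). Let $\tau\ge 1$ be an integer, $\tau^*>\tau$ real, $\sigma>0$, and $\Sigma\in\mathbb R^{k\times k}$ symmetric positive definite. The Gaussian sparse histogram mechanism $\mathcal M$ outputs, for every group $i$, the row $$\mathcal M(X)_i=\begin{cases}\big(C(X,G_i)+v_i,\;A(X,G_i)+m_i\big) & \text{if } C(X,G_i)\ge\tau \text{ and } C(X,G_i)+v_i\ge\tau^*,\\ \emptyset \text{ (null row)} & \text{otherwise,}\end{cases}$$ where $v_i\sim N(0,\sigma^2)$ and $m_i\sim N(0,\Sigma)$ are all independent. $\mathcal M$ is $(\epsilon,\delta)$-DP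 if $\Pr(\mathcal M(X)\in S)\le e^{\epsilon}\Pr(\mathcal M(X')\in S)+\delta$ for all neighbors $X,X'$ and all measurable $S$. Let $$Q_A=\Big\{\big(A(X,G_i)-A(X',G_i)\big)^{T}\Sigma^{-1}\big(A(X,G_i)-A(X',G_i)\big)\;:\; i\in I,\ X,X'\text{ neighbors}\Big\}.$$ Let $\mu_o\ge 0$. With $\Phi$ the standard normal distribution function, put $\beta=\Phi\big(\frac{\tau^*-\tau}{\sigma}\big)$, $f(\mu,\epsilon)=\Phi\big(\frac\mu2-\frac\epsilon\mu\big)-e^{\epsilon}\,\Phi\big(-\frac\mu2-\frac\epsilon\mu\big)$, $\mu(a_+)=\sqrt{a_+/\sigma^2+a_+\mu_o^2}$, $\epsilon_2(a_=)=\epsilon-a_=\log\beta$, $\epsilon_3(a_=)=\epsilon+a_=\log\beta$, and $$D(\epsilon)=\max\Big[\,1-\beta^{C_u},\ \max_{a_++a_==C_u,\ a_+>0}\Big(1-\beta^{a_=}+\beta^{a_=} f\big(\mu(a_+),\epsilon_2(a_=)\big)\Big),\ \max_{a_++a_==C_u,\ a_+>0} f\big(\mu(a_+),\epsilon_3(a_=)\big)\Big],$$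 the inner maxima being over nonnegative integers $a_+,a_=$. **Theorem.** (a) (Privacy.) For every aggregation function $A$ with $\sup Q_A=\mu_o^2$ and all $\epsilon\ge 0$, $\delta\in[0,1]$: if $D(\epsilon)\le\delta$, then $\mathcal M$ is $(\epsilon,\delta)$-DP. (b) (Exactness.) Suppose that the set of potential users is infinite, that there are at least $C_u$ groups, that the set of possible values of the other information is non-empty, and that $\mu_o=0$ if $k=0$. Then there is an aggregation function $A$ with $\max Q_A=\mu_o^2$ such that for all $\epsilon\ge 0$ and $\delta\in[0,1]$: $\mathcal M$ is $(\epsilon,\delta)$-DP if and only if $D(\epsilon)\le\delta$. In particular, the condition $D(\epsilon)\le\delta$ cannot be weakened without further assumptions on $A$ and the groups. -/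

import Mathlib

open MeasureTheory ProbabilityTheory

noncomputable section

namespace GSHM

/-! ### Differential privacy -/

/-- `(ε, δ)`-differential privacy of the randomized mechanism `M` (given by its output law on each
dataset) with respect to the neighbouring relation `nbr`. -/
def IsDP {D Ω : Type*} [MeasurableSpace Ω] (nbr : D → D → Prop) (M : D → Measure Ω)
    (ε δ : ℝ) : Prop :=
  ∀ X X' : D, nbr X X' → ∀ S : Set Ω, MeasurableSet S →
    (M X).real S ≤ Real.exp ε * (M X').real S + δ

/-! ### Datasets -/

/-- A record `(userID, groupID, otherInfo)`. -/
structure Record (U ι T : Type*) where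
  user : U
  group : ι
  info : T

open Classical in
/-- A (user-group aggregated) dataset: a finite set of records in which every user has at most one
record per group and contributes at most `Cu` records. -/
structure Dataset (U ι T : Type*) (Cu : ℕ) where
  records : Finset (Record U ι T)
  unique : ∀ r ∈ records, ∀ s ∈ records, r.user = s.user → r.group = s.group → r = s
  bounded : ∀ u : U, (records.filter (fun r => r.user = u)).card ≤ Cu

variable {U ι T : Type*} {Cu : ℕ}

open Classical in
/-- The records of `X` that lie in group `i`. -/
def Dataset.inGroup (X : Dataset U ι T Cu) (i : ι) : Finset (Record U ι T) :=
  X.records.filter (fun r => r.group = i)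

/-- The number of records of `X` in group `i`. -/
def Dataset.count (X : Dataset U ι T Cu) (i : ι) : ℕ := (X.inGroup i).card

open Classical in
/-- `X` is `X'` with some user removed. -/
def IsRemoval (X X' : Dataset U ι T Cu) : Prop :=
  ∃ u : U, X.records = X'.records.filter (fun r => r.user ≠ u)

/-- Two datasets are neighbours if one arises from the other by adding records of one user. -/
def Neighbors (X X' : Dataset U ι T Cu) : Prop := IsRemoval X X' ∨ IsRemoval X' X

/-! ### The Gaussian sparse histogram mechanism

The number of columns is `m = k + 1`: the count and `k` further aggregates; `k = 0` is the case of a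
count-only query. -/

/-- An aggregation function: for each group, a vector of `k` reals computed from the records of the
group. -/
abbrev Aggregation (U ι T : Type*) (k : ℕ) : Type _ :=
  ι → Finset (Record U ι T) → EuclideanSpace ℝ (Fin k)

/-- An output row: either the null row, or the noisy count with the noisy aggregates. -/
abbrev Row (k : ℕ) : Type := Unit ⊕ (ℝ × EuclideanSpace ℝ (Fin k))

/-- The law of the noise `(v i, n i)`, independent over the groups `i` and with
`v i ∼ N(0, σ²)`, `n i ∼ N(0, Σ)` independent. -/
def noiseLaw (ι : Type*) {k : ℕ} (σ : ℝ) (Sig : Matrix (Fin k) (Fin k) ℝ) :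
    Measure (ι → ℝ × EuclideanSpace ℝ (Fin k)) :=
  Measure.infinitePi fun _ : ι =>
    (gaussianReal 0 (Real.toNNReal (σ ^ 2))).prod (multivariateGaussian 0 Sig)

/-- The output of the mechanism as a function of the noise. -/
def output {k : ℕ} (A : Aggregation U ι T k) (τ : ℕ) (τs : ℝ) (X : Dataset U ι T Cu)
    (z : ι → ℝ × EuclideanSpace ℝ (Fin k)) : ι → Row k := fun i =>
  open Classical in
  if τ ≤ X.count i ∧ τs ≤ (X.count i : ℝ) + (z i).1 then
    Sum.inr ((X.count i : ℝ) + (z i).1, A i (X.inGroup i) + (z i).2)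
  else Sum.inl ()

theorem measurable_output {k : ℕ} (A : Aggregation U ι T k) (τ : ℕ) (τs : ℝ)
    (X : Dataset U ι T Cu) : Measurable (output A τ τs X) := by
  classical
  refine measurable_pi_lambda _ fun i => ?_
  refine Measurable.ite ?_ ?_ measurable_const
  · by_cases h : τ ≤ X.count i
    · simp only [h, true_and]
      exact measurableSet_le measurable_const (by fun_prop)
    · simp [h]
  · exact measurable_inr.comp (by fun_prop)

/-- The Gaussian sparse histogram mechanism with thresholds `τ`, `τs`, count noise `σ`, aggregate
noise covariance `Sig` and aggregation function `A`: the law of its output on the dataset `X`. -/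
def gshm {k : ℕ} (A : Aggregation U ι T k) (τ : ℕ) (τs σ : ℝ) (Sig : Matrix (Fin k) (Fin k) ℝ)
    (X : Dataset U ι T Cu) : Measure (ι → Row k) :=
  (noiseLaw ι σ Sig).map (output A τ τs X)

instance {k : ℕ} (A : Aggregation U ι T k) (τ : ℕ) (τs σ : ℝ) (Sig : Matrix (Fin k) (Fin k) ℝ)
    (X : Dataset U ι T Cu) : IsProbabilityMeasure (gshm A τ τs σ Sig X) := by
  have : IsProbabilityMeasure (noiseLaw ι σ Sig) := by unfold noiseLaw; infer_instance
  exact Measure.isProbabilityMeasure_map (measurable_output A τ τs X).aemeasurable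

/-- The values `(A(X,Gᵢ) - A(X',Gᵢ))ᵀ Σ⁻¹ (A(X,Gᵢ) - A(X',Gᵢ))` over all groups `i` and all
neighbouring datasets `X`, `X'`; their maximum is `μₒ²`. -/
def sensitivitySet {k : ℕ} (Cu : ℕ) (A : Aggregation U ι T k) (Sig : Matrix (Fin k) (Fin k) ℝ) :
    Set ℝ :=
  {q | ∃ (i : ι) (X X' : Dataset U ι T Cu), Neighbors X X' ∧
    q = (A i (X.inGroup i) - A i (X'.inGroup i)).ofLp ⬝ᵥ
      (Sig⁻¹.mulVec (A i (X.inGroup i) - A i (X'.inGroup i)).ofLp)}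

/-! ### The privacy accounting -/

/-- The standard normal distribution function `Φ`. -/
def Phi (x : ℝ) : ℝ := cdf (gaussianReal 0 1) x

/-- The analytic Gaussian expression `Φ(μ/2 - ε/μ) - e^ε Φ(-μ/2 - ε/μ)`. -/
def analyticGaussian (μ ε : ℝ) : ℝ :=
  Phi (μ / 2 - ε / μ) - Real.exp ε * Phi (-μ / 2 - ε / μ)

/-- `μ(a₊) = √(a₊/σ² + a₊ μₒ²)`. -/
def muPlus (σ μo : ℝ) (ap : ℕ) : ℝ := Real.sqrt (ap / σ ^ 2 + ap * μo ^ 2)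

/-- `ε₂(a₌) = ε - a₌ log Φ((τ* - τ)/σ)`. -/
def eps2 (τ : ℕ) (τs σ ε : ℝ) (ae : ℕ) : ℝ := ε - ae * Real.log (Phi ((τs - τ) / σ))

/-- `ε₃(a₌) = ε + a₌ log Φ((τ* - τ)/σ)`. -/
def eps3 (τ : ℕ) (τs σ ε : ℝ) (ae : ℕ) : ℝ := ε + ae * Real.log (Phi ((τs - τ) / σ))

/-- The pairs `(a₊, a₌)` of natural numbers with `a₊ + a₌ = Cu` and `a₊ > 0`. -/
def splits (Cu : ℕ) : Finset (ℕ × ℕ) := (Finset.HasAntidiagonal.antidiagonal Cu).filter (fun p => 0 < p.1)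

theorem splits_nonempty {Cu : ℕ} (hCu : 1 ≤ Cu) : (splits Cu).Nonempty :=
  ⟨(Cu, 0), by simp [splits]; omega⟩

/-- The three-term maximum. -/
def gshmDelta (Cu : ℕ) (hCu : 1 ≤ Cu) (τ : ℕ) (τs σ μo ε : ℝ) : ℝ :=
  max (1 - Phi ((τs - τ) / σ) ^ Cu) (max
    ((splits Cu).sup' (splits_nonempty hCu) fun p =>
      1 - Phi ((τs - τ) / σ) ^ p.2 +
        Phi ((τs - τ) / σ) ^ p.2 * analyticGaussian (muPlus σ μo p.1) (eps2 τ τs σ ε p.2))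
    ((splits Cu).sup' (splits_nonempty hCu) fun p =>
      analyticGaussian (muPlus σ μo p.1) (eps3 τ τs σ ε p.2)))

end GSHM

end

open MeasureTheory ProbabilityTheory

open scoped ENNReal NNReal

noncomputable section

namespace GSHM

/-! ### Pairs of measures with a Gaussian log-likelihood ratio -/

/-! Adding a user raises the count by one in at most C_u groups. Of these, a₊ groups (`Jp`) already
hold at least τ records and a₌ groups (`Je`) hold τ - 1; the others have null rows before and after.
A row of `Je` is always null on X, and null with probability β on X'. When all of them are null, the
output on X' is the output on X with the noise shifted by a vector `h` supported on `Jp`. As X never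
shows the noise of `Je`, that event is independent of the shifted output
(`Addition.noiseLaw_inter`). So the law on X' is a mixture: with weight β^a₌ the mechanism on X run
with shifted noise, with weight 1 - β^a₌ outputs that X never produces.

A shift of Gaussian noise has log-likelihood ratio L - q/2 with L ∼ N(0, q), where q is the squared
Mahalanobis length. By Neyman-Pearson, Q(B) - e^ε P(B) is at most f(√q, ε) (`GaussLR.real_sub_le`),
with equality for a half-space in L (`GaussLR.real_region_sub`). The weight β^a₌ only rescales e^ε,
which produces ε₂ and ε₃ in the two directions. Each row adds at most 1/σ² + μₒ² to q and f
increases in μ (`analyticGaussian_mono`), so it suffices to consider a₊ + a₌ = C_u; the case a₊ = 0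
leaves 1 - β^C_u.

For exactness, let A be the count times a vector w of Mahalanobis length μₒ, so that every shift is
extremal, and let the counts in `Jp` tend to infinity. The threshold then hides a row of `Jp` with
vanishing probability, so the optimal test on the noise can be carried out on the output. -/

/-- `L - q / 2` is the log-likelihood ratio of `Q` with respect to `P`, where `L ∼ N(0, q)`
under `P`. -/
structure GaussLR {Ω : Type*} [MeasurableSpace Ω] (q : ℝ≥0) (L : Ω → ℝ) (P Q : Measure Ω) :
    Prop where
  measurable : Measurable L
  law : P.map L = gaussianReal 0 q
  density : Q = P.withDensity fun x => ENNReal.ofReal (Real.exp (L x - q / 2))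

theorem map_withDensity_comp {Ω Ω' : Type*} [MeasurableSpace Ω] [MeasurableSpace Ω']
    {P : Measure Ω} {e : Ω → Ω'} (he : Measurable e) {g : Ω' → ℝ≥0∞} (hg : Measurable g) :
    (P.withDensity (fun x => g (e x))).map e = (P.map e).withDensity g := by
  ext s hs
  rw [Measure.map_apply he hs, withDensity_apply _ (he hs), withDensity_apply _ hs,
    setLIntegral_map hs hg he]

theorem gaussLR_gaussianReal {v q : ℝ≥0} (a : ℝ) (hv : v ≠ 0) (hq : (q : ℝ) = a ^ 2 / v) :
    GaussLR q (fun x => a * x / v) (gaussianReal 0 v) (gaussianReal a v) where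
  measurable := by fun_prop
  law := by
    have hv' : (v : ℝ) ≠ 0 := by exact_mod_cast hv
    have : (fun x : ℝ => a * x / v) = fun x => (a / v) * x := by ext x; ring
    rw [this, gaussianReal_map_const_mul, mul_zero]
    congr 1
    apply NNReal.coe_injective
    rw [hq, NNReal.coe_mul]
    change (a / v) ^ 2 * (v : ℝ) = _
    field_simp
  density := by
    have hv' : (v : ℝ) ≠ 0 := by exact_mod_cast hv
    rw [gaussianReal_of_var_ne_zero _ hv, gaussianReal_of_var_ne_zero _ hv,
      ← withDensity_mul _ (measurable_gaussianPDF _ _) (by fun_prop)]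
    congr 1
    ext x
    simp only [Pi.mul_apply, gaussianPDF]
    rw [← ENNReal.ofReal_mul (gaussianPDFReal_nonneg _ _ _), gaussianPDFReal, gaussianPDFReal,
      mul_assoc (√_)⁻¹, ← Real.exp_add]
    congr 3
    rw [hq]
    field_simp
    ring

namespace GaussLR

variable {Ω Ω' : Type*} [MeasurableSpace Ω] [MeasurableSpace Ω'] {q q' : ℝ≥0} {L : Ω → ℝ}
  {L' : Ω' → ℝ} {P Q : Measure Ω} {P' Q' : Measure Ω'}

/-- The likelihood ratio factors through `e`, so `e` is a sufficient statistic and pushing forward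
loses nothing. -/
theorem map (h : GaussLR q L P Q) {e : Ω → Ω'} (he : Measurable e) (hL' : Measurable L')
    (hL : ∀ x, L' (e x) = L x) : GaussLR q L' (P.map e) (Q.map e) where
  measurable := hL'
  law := by
    rw [Measure.map_map hL' he, ← h.law]
    congr 1
    exact funext hL
  density := by
    rw [← map_withDensity_comp he (by fun_prop), h.density]
    simp only [hL]

theorem map_right (h : GaussLR q L P Q) : Q.map L = gaussianReal q q := by
  rw [h.density, map_withDensity_comp (g := fun y => ENNReal.ofReal (Real.exp (y - q / 2)))
    h.measurable (by fun_prop), h.law]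
  rcases eq_or_ne q 0 with rfl | hq
  · simp [dirac_withDensity' (f := fun y : ℝ => ENNReal.ofReal (Real.exp y)) (by fun_prop)]
  · have hq' : (q : ℝ) ≠ 0 := by exact_mod_cast hq
    -- With mean shift equal to the variance, the ratio `a * x / v` becomes `x`, so tilting N(0, q)
    -- gives N(q, q).
    have := (gaussLR_gaussianReal (v := q) (q := q) q hq (by field_simp)).density
    rw [this]
    congr 1
    ext x
    rw [mul_div_cancel_left₀ _ hq']

/-- Under `Q` the variable `L` has law N(q, q), so `q - L` is centred again. This makes one bound
serve both neighbour directions. -/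
theorem symm (h : GaussLR q L P Q) : GaussLR q (fun x => q - L x) Q P where
  measurable := measurable_const.sub h.measurable
  law := by
    have : (fun x => q - L x) = (fun y : ℝ => q - y) ∘ L := rfl
    rw [this, ← Measure.map_map (by fun_prop) h.measurable, h.map_right,
      gaussianReal_map_const_sub, sub_self]
  density := by
    have hm := h.measurable
    have h1 : Measurable fun x => ENNReal.ofReal (Real.exp (L x - q / 2)) := by fun_prop
    rw [h.density, ← withDensity_mul _ h1 (by fun_prop)]
    convert (withDensity_one (μ := P)).symm using 2
    ext x
    rw [Pi.mul_apply, ← ENNReal.ofReal_mul (Real.exp_nonneg _), ← Real.exp_add]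
    ring_nf
    simp

theorem prod [IsProbabilityMeasure P] [IsProbabilityMeasure P'] (h : GaussLR q L P Q)
    (h' : GaussLR q' L' P' Q') :
    GaussLR (q + q') (fun x : Ω × Ω' => L x.1 + L' x.2) (P.prod P') (Q.prod Q') where
  measurable := (h.measurable.comp measurable_fst).add (h'.measurable.comp measurable_snd)
  law := by
    have h1 : (P.prod P').map (fun x => L x.1) = gaussianReal 0 q := by
      rw [← h.law, ← Function.comp_def L Prod.fst, ← Measure.map_map h.measurable measurable_fst,
        Measure.map_fst_prod]
      simp
    have h2 : (P.prod P').map (fun x => L' x.2) = gaussianReal 0 q' := by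
      rw [← h'.law, ← Function.comp_def L' Prod.snd,
        ← Measure.map_map h'.measurable measurable_snd, Measure.map_snd_prod]
      simp
    have := gaussianReal_add_gaussianReal_of_indepFun
      (indepFun_prod (μ := P) (ν := P') h.measurable h'.measurable) h1 h2
    rwa [add_zero] at this
  density := by
    have hm := h.measurable
    have hm' := h'.measurable
    have : SFinite Q := by rw [h.density]; infer_instance
    have : SFinite Q' := by rw [h'.density]; infer_instance
    conv_lhs => rw [h.density, h'.density]
    rw [prod_withDensity (by fun_prop) (by fun_prop)]
    congr 1
    ext x
    rw [← ENNReal.ofReal_mul (Real.exp_nonneg _), ← Real.exp_add, NNReal.coe_add]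
    congr 2
    ring

end GaussLR

/-- The indicator of the box is absorbed into the factors, and independence splits the integral.
Both index sets are padded to `s ∪ J`: outside `J` the density factor is 1, outside `s` the integral
is 1. -/
theorem setLIntegral_pi_finset_prod {ι Ω : Type*} [MeasurableSpace Ω] (P : ι → Measure Ω)
    [∀ i, IsProbabilityMeasure (P i)] (J s : Finset ι) (g : ι → Ω → ℝ≥0∞)
    (hg : ∀ i, Measurable (g i)) (hJ : ∀ i ∉ J, g i = 1) (t : ι → Set Ω)
    (ht : ∀ i, MeasurableSet (t i)) (h1 : ∀ i, ∫⁻ x, g i x ∂P i = 1) :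
    ∫⁻ x in Set.pi s t, ∏ i ∈ J, g i (x i) ∂Measure.infinitePi P =
      ∏ i ∈ s, ∫⁻ x in t i, g i x ∂P i := by
  classical
  let F : ι → Ω → ℝ≥0∞ := fun i => if i ∈ s then (t i).indicator (g i) else g i
  have hF : ∀ i, Measurable (F i) := by
    intro i
    by_cases hi : i ∈ s
    · simpa [F, hi] using (hg i).indicator (ht i)
    · simpa [F, hi] using hg i
  have hs : MeasurableSet (Set.pi (s : Set ι) t) :=
    MeasurableSet.pi s.countable_toSet fun i _ => ht i
  have key : (Set.pi (s : Set ι) t).indicator (fun x => ∏ i ∈ J, g i (x i)) =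
      fun x => ∏ i ∈ s ∪ J, F i (x i) := by
    ext x
    by_cases hx : x ∈ Set.pi (s : Set ι) t
    · rw [Set.indicator_of_mem hx, Finset.prod_subset (Finset.subset_union_right (s₁ := s))
        (fun i _ hi => by simp [hJ i hi])]
      refine Finset.prod_congr rfl fun i _ => ?_
      by_cases hi : i ∈ s
      · simp [F, hi, Set.indicator_of_mem (hx i hi)]
      · simp [F, hi]
    · rw [Set.indicator_of_notMem hx]
      simp only [Set.mem_pi, not_forall] at hx
      obtain ⟨i, hi, hit⟩ := hx
      have hi' : i ∈ s := hi
      symm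
      apply Finset.prod_eq_zero (Finset.mem_union_left _ hi')
      simp [F, hi', hit]
  rw [← lintegral_indicator hs, key]
  have hind := iIndepFun_infinitePi (P := P) hF
  rw [lintegral_prod_eq_prod_lintegral_of_indepFun _ (fun i (x : ι → Ω) => F i (x i)) hind
    (fun i => (hF i).comp (measurable_pi_apply i))]
  have hev : ∀ i, ∫⁻ x, F i (x i) ∂Measure.infinitePi P = ∫⁻ x, F i x ∂P i := fun i => by
    rw [← Measure.infinitePi_map_eval P i, lintegral_map (hF i) (measurable_pi_apply i)]
  simp only [hev]
  rw [← Finset.prod_subset (Finset.subset_union_left (s₁ := s)) (fun i _ hi => by simp [F, hi, h1])]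
  refine Finset.prod_congr rfl fun i hi => ?_
  simp [F, hi, lintegral_indicator (ht i)]

theorem GaussLR.infinitePi {ι Ω : Type*} [MeasurableSpace Ω] (P Q : ι → Measure Ω)
    [∀ i, IsProbabilityMeasure (P i)] [∀ i, IsProbabilityMeasure (Q i)] (q : ι → ℝ≥0)
    (L : ι → Ω → ℝ) (J : Finset ι) (hJ : ∀ i ∈ J, GaussLR (q i) (L i) (P i) (Q i))
    (hJ' : ∀ i ∉ J, Q i = P i) :
    GaussLR (∑ i ∈ J, q i) (fun x => ∑ i ∈ J, L i (x i)) (Measure.infinitePi P)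
      (Measure.infinitePi Q) where
  measurable := Finset.measurable_sum _ fun i hi => (hJ i hi).measurable.comp (measurable_pi_apply i)
  law := by
    classical
    -- Nothing is known about `L i` off `J`; replacing it by 0 makes the whole family measurable, as
    -- independence requires.
    let L' : ι → Ω → ℝ := fun i => if i ∈ J then L i else 0
    have hL' : ∀ i, Measurable (L' i) := by
      intro i
      by_cases hi : i ∈ J
      · simpa [L', hi] using (hJ i hi).measurable
      · simpa [L', hi] using measurable_zero
    have hind := iIndepFun_infinitePi (P := P) hL'
    have key : ∀ s ⊆ J, (Measure.infinitePi P).map (∑ i ∈ s, fun x : ι → Ω => L' i (x i)) =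
        gaussianReal 0 (∑ i ∈ s, q i) := by
      intro s
      induction s using Finset.induction_on with
      | empty =>
        intro _
        simp only [Finset.sum_empty, gaussianReal_zero_var]
        rw [show (0 : (ι → Ω) → ℝ) = fun _ => 0 from rfl, Measure.map_const]
        simp
      | insert i s his ih =>
        intro hs
        have hi : i ∈ J := hs (Finset.mem_insert_self _ _)
        have h2 : (Measure.infinitePi P).map (fun x => L' i (x i)) = gaussianReal 0 (q i) := by
          rw [← Function.comp_def (L' i) (fun x : ι → Ω => x i),
            ← Measure.map_map (hL' i) (measurable_pi_apply i), Measure.infinitePi_map_eval]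
          simpa [L', hi] using (hJ i hi).law
        have := gaussianReal_add_gaussianReal_of_indepFun
          (hind.indepFun_finsetSum_of_notMem (fun i => (hL' i).comp (measurable_pi_apply i)) his)
          (ih ((Finset.subset_insert _ _).trans hs)) h2
        rw [Finset.sum_insert his, Finset.sum_insert his, add_comm, this, add_zero, add_comm (q i)]
    rw [← key J subset_rfl]
    congr 1
    ext x
    rw [Finset.sum_apply]
    exact Finset.sum_congr rfl fun i hi => by simp [L', hi]
  density := by
    classical
    let g : ι → Ω → ℝ≥0∞ := fun i =>
      if i ∈ J then fun y => ENNReal.ofReal (Real.exp (L i y - q i / 2)) else 1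
    have hg : ∀ i, Measurable (g i) := by
      intro i
      by_cases hi : i ∈ J
      · have := (hJ i hi).measurable
        simp only [g, hi, if_true]
        fun_prop
      · simpa [g, hi] using measurable_one
    have hQ : ∀ i, Q i = (P i).withDensity (g i) := by
      intro i
      by_cases hi : i ∈ J
      · simpa [g, hi] using (hJ i hi).density
      · simp [g, hi, hJ' i hi]
    have h1 : ∀ i, ∫⁻ x, g i x ∂P i = 1 := fun i => by
      rw [← setLIntegral_univ, ← withDensity_apply _ MeasurableSet.univ, ← hQ, measure_univ]
    symm
    refine Measure.eq_infinitePi Q fun s t ht => ?_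
    have hs : MeasurableSet (Set.pi (s : Set ι) t) :=
      MeasurableSet.pi s.countable_toSet fun i _ => ht i
    rw [withDensity_apply _ hs]
    have hprod : ∀ x : ι → Ω, ENNReal.ofReal (Real.exp (∑ i ∈ J, L i (x i) -
        (∑ i ∈ J, q i : ℝ≥0) / 2)) = ∏ i ∈ J, g i (x i) := by
      intro x
      rw [NNReal.coe_sum, Finset.sum_div, ← Finset.sum_sub_distrib, Real.exp_sum,
        ENNReal.ofReal_prod_of_nonneg fun i _ => Real.exp_nonneg _]
      exact Finset.prod_congr rfl fun i hi => by simp [g, hi]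
    simp only [hprod]
    rw [setLIntegral_pi_finset_prod P J s g hg (fun i hi => by simp [g, hi]) t ht h1]
    refine Finset.prod_congr rfl fun i _ => ?_
    rw [hQ i, withDensity_apply _ (ht i)]

/-! ### Hockey-stick divergence -/

theorem gaussianReal_real_Ioi (m c : ℝ) {v : ℝ≥0} (hv : v ≠ 0) :
    (gaussianReal m v).real (Set.Ioi c) = Phi ((m - c) / Real.sqrt v) := by
  have hs : 0 < Real.sqrt v := Real.sqrt_pos.2 (by positivity)
  have hmap : (gaussianReal m v).map (fun x => (m - x) / Real.sqrt v) = gaussianReal 0 1 := by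
    have : (fun x : ℝ => (m - x) / Real.sqrt v) = (fun y => y / Real.sqrt v) ∘ (fun x => m - x) :=
      rfl
    rw [this, ← Measure.map_map (by fun_prop) (by fun_prop), gaussianReal_map_const_sub,
      gaussianReal_map_div_const, sub_self, zero_div]
    congr 1
    apply NNReal.coe_injective
    rw [NNReal.coe_div]
    change (v : ℝ) / Real.sqrt v ^ 2 = 1
    rw [Real.sq_sqrt v.coe_nonneg, div_self (by exact_mod_cast hv)]
  have := nullSingletonClass_gaussianReal (μ := m) hv
  rw [Phi, cdf_eq_real, ← hmap, map_measureReal_apply (by fun_prop) measurableSet_Iic,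
    measureReal_congr (Ioi_ae_eq_Ici (a := c))]
  congr 1
  ext x
  simp only [Set.mem_Ici, Set.mem_preimage, Set.mem_Iic]
  rw [div_le_div_iff_of_pos_right hs]
  constructor <;> intro h <;> linarith

namespace GaussLR

variable {Ω : Type*} [MeasurableSpace Ω] {q : ℝ≥0} {L : Ω → ℝ} {P Q : Measure Ω}

/-- The rejection region of the Neyman-Pearson test at level `ε`. -/
def region (q : ℝ≥0) (L : Ω → ℝ) (ε : ℝ) : Set Ω := {x | ε + q / 2 < L x}

theorem measurableSet_region (h : GaussLR q L P Q) (ε : ℝ) : MeasurableSet (region q L ε) :=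
  measurableSet_lt measurable_const h.measurable

/-- The region is where the density of `Q` exceeds `exp ε`. Its two probabilities are the tails
beyond ε + q/2 of N(q, q) and N(0, q). -/
theorem real_region_sub (h : GaussLR q L P Q) (hq : q ≠ 0) (ε : ℝ) :
    Q.real (region q L ε) - Real.exp ε * P.real (region q L ε) =
      analyticGaussian (Real.sqrt q) ε := by
  have hs : 0 < Real.sqrt q := Real.sqrt_pos.2 (by positivity)
  have hr : region q L ε = L ⁻¹' Set.Ioi (ε + q / 2) := rfl
  have hsq : (q : ℝ) = Real.sqrt q * Real.sqrt q := (Real.mul_self_sqrt q.coe_nonneg).symm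
  rw [hr, ← map_measureReal_apply h.measurable measurableSet_Ioi,
    ← map_measureReal_apply h.measurable measurableSet_Ioi, h.law, h.map_right,
    gaussianReal_real_Ioi _ _ hq, gaussianReal_real_Ioi _ _ hq, analyticGaussian]
  generalize Real.sqrt q = s at *
  rw [hsq]
  congr 3
  · field_simp; ring
  · field_simp; ring

/-- Neyman-Pearson: the density of `Q` minus `exp ε` is positive exactly on `H`, so removing `B \ H`
from `B` and adding `H \ B` can only increase the difference. -/
theorem real_sub_le [IsProbabilityMeasure P] [IsProbabilityMeasure Q] (h : GaussLR q L P Q)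
    (hq : q ≠ 0) (ε : ℝ) {B : Set Ω} (hB : MeasurableSet B) :
    Q.real B - Real.exp ε * P.real B ≤ analyticGaussian (Real.sqrt q) ε := by
  rw [← h.real_region_sub hq]
  have hH := h.measurableSet_region ε
  set H := region q L ε
  have h1 : Q.real (B \ H) ≤ Real.exp ε * P.real (B \ H) := by
    have : Q (B \ H) ≤ ENNReal.ofReal (Real.exp ε) * P (B \ H) := by
      conv_lhs => rw [h.density]
      rw [withDensity_apply _ (hB.diff hH), ← setLIntegral_const]
      refine setLIntegral_mono measurable_const fun x hx => ?_
      have : L x ≤ ε + q / 2 := not_lt.1 hx.2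
      exact ENNReal.ofReal_le_ofReal (Real.exp_le_exp.2 (by linarith))
    have := ENNReal.toReal_mono (by finiteness) this
    rwa [ENNReal.toReal_mul, ENNReal.toReal_ofReal (Real.exp_nonneg _)] at this
  have h2 : Real.exp ε * P.real (H \ B) ≤ Q.real (H \ B) := by
    have : ENNReal.ofReal (Real.exp ε) * P (H \ B) ≤ Q (H \ B) := by
      conv_rhs => rw [h.density]
      have hm := h.measurable
      rw [withDensity_apply _ (hH.diff hB), ← setLIntegral_const]
      refine setLIntegral_mono (by fun_prop) fun x hx => ?_
      have : ε + q / 2 < L x := hx.1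
      exact ENNReal.ofReal_le_ofReal (Real.exp_le_exp.2 (by linarith))
    have := ENNReal.toReal_mono (by finiteness) this
    rwa [ENNReal.toReal_mul, ENNReal.toReal_ofReal (Real.exp_nonneg _)] at this
  have e1 := measureReal_inter_add_sdiff (μ := Q) (s := B) hH
  have e2 := measureReal_inter_add_sdiff (μ := P) (s := B) hH
  have e3 := measureReal_inter_add_sdiff (μ := Q) (s := H) hB
  have e4 := measureReal_inter_add_sdiff (μ := P) (s := H) hB
  rw [Set.inter_comm] at e3 e4
  rw [← e1, ← e2, ← e3, ← e4]
  linarith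

end GaussLR

/-- No calculus is needed: shifting two independent standard normals by μ and √(ν² - μ²) gives total
parameter ν². A test that looks only at the first achieves the value at μ, and no test exceeds the
value at ν. -/
theorem analyticGaussian_mono {μ ν : ℝ} (hμ : 0 < μ) (hμν : μ ≤ ν) (ε : ℝ) :
    analyticGaussian μ ε ≤ analyticGaussian ν ε := by
  have h1 := gaussLR_gaussianReal (v := 1) (q := Real.toNNReal (μ ^ 2)) μ one_ne_zero
    (by simp [sq_nonneg])
  have hd : 0 ≤ ν ^ 2 - μ ^ 2 := by nlinarith
  have h2 := gaussLR_gaussianReal (v := 1) (q := Real.toNNReal (ν ^ 2 - μ ^ 2))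
    (Real.sqrt (ν ^ 2 - μ ^ 2)) one_ne_zero (by simp [hd])
  have h := h1.prod h2
  rw [← Real.toNNReal_add (sq_nonneg _) hd, add_sub_cancel] at h
  have hν : 0 < ν := hμ.trans_le hμν
  have hle := h.real_sub_le (by simpa using hν.ne') ε
    ((h1.measurableSet_region ε).prod MeasurableSet.univ)
  rw [measureReal_prod_prod, measureReal_prod_prod] at hle
  simp only [probReal_univ, mul_one] at hle
  rw [h1.real_region_sub (by simpa using hμ.ne')] at hle
  simpa [Real.sqrt_sq, hμ.le, hν.le, sq_nonneg] using hle

/-! ### Shifts of the noise -/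

section Noise

variable {k : ℕ} {Sig : Matrix (Fin k) (Fin k) ℝ}

open Matrix MatrixOrder in
theorem gaussLR_multivariateGaussian (hSig : Sig.PosDef) (h : EuclideanSpace ℝ (Fin k)) {q : ℝ≥0}
    (hq : (q : ℝ) = h.ofLp ⬝ᵥ Sig⁻¹ *ᵥ h.ofLp) :
    GaussLR q (fun y => h.ofLp ⬝ᵥ Sig⁻¹ *ᵥ y.ofLp) (multivariateGaussian 0 Sig)
      ((multivariateGaussian 0 Sig).map (· + h)) := by
  -- Whitening: the noise is `R x` with `x` standard normal, and a shift by `h` is a shift of `x` by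
  -- `w = R⁻¹ h`, with independent coordinates and ratio `w ⬝ᵥ x`.
  obtain ⟨R, hRdef⟩ : ∃ R, R = CFC.sqrt Sig := ⟨_, rfl⟩
  have hRR : R * R = Sig := by
    rw [hRdef]
    exact CFC.sqrt_mul_sqrt_self Sig hSig.posSemidef.nonneg
  have hRsymm : Rᵀ = R := by
    have := (CFC.sqrt_nonneg Sig).isSelfAdjoint
    rw [← hRdef, IsSelfAdjoint, star_eq_conjTranspose, conjTranspose_eq_transpose_of_trivial]
      at this
    exact this
  have hRdet : IsUnit R.det := by
    have h1 : R.det * R.det = Sig.det := by rw [← det_mul, hRR]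
    exact isUnit_iff_ne_zero.2 fun h0 => hSig.det_pos.ne' (by rw [← h1, h0, zero_mul])
  have hinv : R * Sig⁻¹ * R = 1 := by
    rw [← hRR, Matrix.mul_inv_rev, ← mul_assoc, mul_nonsing_inv _ hRdet, one_mul,
      nonsing_inv_mul _ hRdet]
  let w : Fin k → ℝ := R⁻¹ *ᵥ h.ofLp
  have hw : R *ᵥ w = h.ofLp := by
    rw [mulVec_mulVec, mul_nonsing_inv _ hRdet, one_mulVec]
  have hdot : ∀ x : Fin k → ℝ, h.ofLp ⬝ᵥ Sig⁻¹ *ᵥ (R *ᵥ x) = w ⬝ᵥ x := by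
    intro x
    rw [← hw, ← vecMul_transpose, hRsymm, ← dotProduct_mulVec, mulVec_mulVec, mulVec_mulVec,
      hinv, one_mulVec]
  let T : (Fin k → ℝ) → EuclideanSpace ℝ (Fin k) := fun x => WithLp.toLp 2 (R *ᵥ x)
  have hT : Measurable T := by
    have : Continuous T := (PiLp.continuous_toLp 2 _).comp
      (Continuous.matrix_mulVec continuous_const continuous_id)
    exact this.measurable
  have hP : (Measure.infinitePi fun _ : Fin k => gaussianReal 0 1).map T =
      multivariateGaussian 0 Sig := by
    rw [multivariateGaussian, ← map_pi_eq_stdGaussian, Measure.map_map (by fun_prop) (by fun_prop),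
      Measure.infinitePi_eq_pi]
    congr 1
    ext x i
    simp [T, hRdef]
  have hQ : (Measure.infinitePi fun i : Fin k => gaussianReal (w i) 1).map T =
      (multivariateGaussian 0 Sig).map (· + h) := by
    have : (fun i : Fin k => gaussianReal (w i) 1) =
        fun i => (gaussianReal 0 1).map (· + w i) := by
      ext1 i
      rw [gaussianReal_map_add_const, zero_add]
    rw [this, ← Measure.infinitePi_map_pi _ (fun i => by fun_prop), ← hP,
      Measure.map_map hT (by fun_prop), Measure.map_map (by fun_prop) hT]
    congr 1
    ext x i
    have : (fun i => x i + w i) = x + w := rfl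
    simp only [Function.comp_apply, T, this, mulVec_add, hw]
    rfl
  have hg := GaussLR.infinitePi (fun _ : Fin k => gaussianReal 0 1)
    (fun i => gaussianReal (w i) 1) (fun i => Real.toNNReal (w i ^ 2)) (fun i x => w i * x / (1 : ℝ≥0))
    Finset.univ (fun i _ => gaussLR_gaussianReal (w i) one_ne_zero (by simp [sq_nonneg])) (by simp)
  have hq' : ∑ i, Real.toNNReal (w i ^ 2) = q := by
    apply NNReal.coe_injective
    have hww := hdot w
    rw [hw] at hww
    rw [hq, hww, dotProduct, NNReal.coe_sum]
    exact Finset.sum_congr rfl fun i _ => by rw [Real.coe_toNNReal _ (sq_nonneg _), sq]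
  rw [hq'] at hg
  rw [← hQ, ← hP]
  refine hg.map hT ?_ fun x => ?_
  · have : Continuous fun y : EuclideanSpace ℝ (Fin k) => h.ofLp ⬝ᵥ Sig⁻¹ *ᵥ y.ofLp :=
      Continuous.dotProduct continuous_const
        (Continuous.matrix_mulVec continuous_const (PiLp.continuous_ofLp 2 _))
    exact this.measurable
  · rw [hdot]
    simp [dotProduct]

/-- The law of the noise in one row. -/
def rowNoise {k : ℕ} (σ : ℝ) (Sig : Matrix (Fin k) (Fin k) ℝ) :
    Measure (ℝ × EuclideanSpace ℝ (Fin k)) :=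
  (gaussianReal 0 (Real.toNNReal (σ ^ 2))).prod (multivariateGaussian 0 Sig)

instance (σ : ℝ) : IsProbabilityMeasure (rowNoise σ Sig) := by
  unfold rowNoise; infer_instance

theorem noiseLaw_eq (ι : Type*) (σ : ℝ) :
    noiseLaw ι σ Sig = Measure.infinitePi fun _ => rowNoise σ Sig := rfl

instance (ι : Type*) (σ : ℝ) : IsProbabilityMeasure (noiseLaw ι σ Sig) := by
  rw [noiseLaw_eq]; infer_instance

open Matrix in
/-- The squared Mahalanobis length of a shift of one row. -/
def rowSq (σ : ℝ) (Sig : Matrix (Fin k) (Fin k) ℝ) (h : ℝ × EuclideanSpace ℝ (Fin k)) : ℝ :=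
  h.1 ^ 2 / σ ^ 2 + h.2.ofLp ⬝ᵥ Sig⁻¹ *ᵥ h.2.ofLp

open Matrix in
/-- The log-likelihood ratio of a shift by `h` of one row, up to a constant. -/
def rowLLR (σ : ℝ) (Sig : Matrix (Fin k) (Fin k) ℝ) (h x : ℝ × EuclideanSpace ℝ (Fin k)) : ℝ :=
  h.1 * x.1 / σ ^ 2 + h.2.ofLp ⬝ᵥ Sig⁻¹ *ᵥ x.2.ofLp

open Matrix in
theorem dotProduct_inv_mulVec_nonneg (hSig : Sig.PosDef) (x : Fin k → ℝ) :
    0 ≤ x ⬝ᵥ Sig⁻¹ *ᵥ x := by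
  simpa using hSig.inv.posSemidef.dotProduct_mulVec_nonneg x

theorem gaussLR_rowNoise {σ : ℝ} (hσ : 0 < σ) (hSig : Sig.PosDef)
    (h : ℝ × EuclideanSpace ℝ (Fin k)) :
    GaussLR (Real.toNNReal (rowSq σ Sig h)) (rowLLR σ Sig h) (rowNoise σ Sig)
      ((rowNoise σ Sig).map (· + h)) := by
  have hσ2 : (Real.toNNReal (σ ^ 2) : ℝ) = σ ^ 2 := Real.coe_toNNReal _ (sq_nonneg _)
  have h0 : Real.toNNReal (σ ^ 2) ≠ 0 := by simpa using hσ.ne'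
  have h1 := gaussLR_gaussianReal (v := Real.toNNReal (σ ^ 2))
    (q := Real.toNNReal (h.1 ^ 2 / σ ^ 2)) h.1 h0
    (by rw [Real.coe_toNNReal _ (by positivity), hσ2])
  have h2 := gaussLR_multivariateGaussian hSig h.2
    (Real.coe_toNNReal _ (dotProduct_inv_mulVec_nonneg hSig _))
  have := h1.prod h2
  rw [← Real.toNNReal_add (by positivity) (dotProduct_inv_mulVec_nonneg hSig _), hσ2] at this
  convert! this using 1
  rw [← zero_add h.1, ← gaussianReal_map_add_const, Measure.map_prod_map _ _ (by fun_prop)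
    (by fun_prop)]
  rfl

/-- The log-likelihood ratio of a shift by `h` of the rows in `J`, up to a constant. -/
def noiseLLR {ι : Type*} (σ : ℝ) (Sig : Matrix (Fin k) (Fin k) ℝ) (J : Finset ι)
    (h z : ι → ℝ × EuclideanSpace ℝ (Fin k)) : ℝ :=
  ∑ i ∈ J, rowLLR σ Sig (h i) (z i)

theorem gaussLR_noiseLaw {ι : Type*} {σ : ℝ} (hσ : 0 < σ) (hSig : Sig.PosDef)
    (J : Finset ι) (h : ι → ℝ × EuclideanSpace ℝ (Fin k)) (hJ : ∀ i ∉ J, h i = 0) :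
    GaussLR (∑ i ∈ J, Real.toNNReal (rowSq σ Sig (h i))) (noiseLLR σ Sig J h)
      (noiseLaw ι σ Sig) ((noiseLaw ι σ Sig).map (· + h)) := by
  have hmap : (noiseLaw ι σ Sig).map (· + h) =
      Measure.infinitePi fun i => (rowNoise σ Sig).map (· + h i) := by
    rw [noiseLaw_eq, ← Measure.infinitePi_map_pi _ (fun i => by fun_prop)]
    rfl
  have : ∀ i, IsProbabilityMeasure ((rowNoise σ Sig).map (· + h i)) := fun i =>
    Measure.isProbabilityMeasure_map (by fun_prop)
  rw [hmap, noiseLaw_eq]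
  exact GaussLR.infinitePi _ _ _ _ J (fun i _ => gaussLR_rowNoise hσ hSig (h i))
    (fun i hi => by simp [hJ i hi])

/-! ### The count noise -/

/-- Positivity gives log β its usual meaning in ε₂ and ε₃. -/
theorem Phi_pos (x : ℝ) : 0 < Phi x := by
  have h := gaussianReal_real_Ioi x 0 (one_ne_zero (α := ℝ≥0))
  simp only [sub_zero, NNReal.coe_one, Real.sqrt_one, div_one] at h
  rw [← h, measureReal_def]
  refine ENNReal.toReal_pos (fun h0 => ?_) (by finiteness)
  have := gaussianReal_absolutelyContinuous' x (one_ne_zero (α := ℝ≥0)) h0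
  simp at this

theorem Phi_le_one (x : ℝ) : Phi x ≤ 1 := cdf_le_one _ _

theorem rowNoise_real_lt {σ : ℝ} (hσ : 0 < σ) (c : ℝ) :
    (rowNoise σ Sig).real {x | x.1 < c} = Phi (c / σ) := by
  have h0 : Real.toNNReal (σ ^ 2) ≠ 0 := by simpa using hσ.ne'
  have : {x : ℝ × EuclideanSpace ℝ (Fin k) | x.1 < c} = (Set.Iio c) ×ˢ Set.univ := by
    ext x; simp
  rw [this, rowNoise, measureReal_prod_prod, probReal_univ, mul_one]
  have h1 := gaussianReal_real_Ioi c 0 h0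
  rw [Real.coe_toNNReal _ (sq_nonneg _), Real.sqrt_sq hσ.le, sub_zero] at h1
  have h2 : (gaussianReal 0 (Real.toNNReal (σ ^ 2))).map (fun x => c - x) =
      gaussianReal c (Real.toNNReal (σ ^ 2)) := by
    rw [gaussianReal_map_const_sub, sub_zero]
  rw [← h1, ← h2, map_measureReal_apply (by fun_prop) measurableSet_Ioi]
  congr 1
  ext x
  simp

theorem noiseLaw_real_forall_lt {ι : Type*} {σ : ℝ} (hσ : 0 < σ) (J : Finset ι) (c : ℝ) :
    (noiseLaw ι σ Sig).real {z | ∀ i ∈ J, (z i).1 < c} = Phi (c / σ) ^ J.card := by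
  have : {z : ι → ℝ × EuclideanSpace ℝ (Fin k) | ∀ i ∈ J, (z i).1 < c} =
      Set.pi J fun _ => {x | x.1 < c} := by
    ext z; simp [Set.mem_pi]
  rw [this, noiseLaw_eq, measureReal_def, Measure.infinitePi_pi _ fun i _ =>
    measurableSet_lt measurable_fst measurable_const, ENNReal.toReal_prod]
  simp only [← measureReal_def, rowNoise_real_lt hσ, Finset.prod_const]

theorem noiseLaw_real_exists_lt_le {ι : Type*} {σ : ℝ} (hσ : 0 < σ) (J : Finset ι) (c : ℝ) :
    (noiseLaw ι σ Sig).real {z | ∃ i ∈ J, (z i).1 < c} ≤ J.card * Phi (c / σ) := by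
  have : {z : ι → ℝ × EuclideanSpace ℝ (Fin k) | ∃ i ∈ J, (z i).1 < c} =
      ⋃ i ∈ J, {z | (z i).1 < c} := by
    ext z; simp
  rw [this]
  refine (measureReal_biUnion_finset_le _ _).trans ?_
  rw [← nsmul_eq_mul, ← Finset.sum_const]
  refine Finset.sum_le_sum fun i _ => le_of_eq ?_
  have := noiseLaw_real_forall_lt (Sig := Sig) hσ {i} c
  simpa using this

/-- An event that does not depend on the rows in `J` is independent of the event that the count
noise of all rows in `J` is below `c`. -/
theorem noiseLaw_real_inter {ι : Type*} {σ : ℝ} (hσ : 0 < σ) (J : Finset ι) (c : ℝ)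
    {B : Set (ι → ℝ × EuclideanSpace ℝ (Fin k))} (hB : MeasurableSet B)
    (hdep : ∀ z z' : ι → ℝ × EuclideanSpace ℝ (Fin k), (∀ i ∉ J, z i = z' i) → z ∈ B → z' ∈ B) :
    (noiseLaw ι σ Sig).real ({z | ∀ i ∈ J, (z i).1 < c} ∩ B) =
      Phi (c / σ) ^ J.card * (noiseLaw ι σ Sig).real B := by
  classical
  rw [← noiseLaw_real_forall_lt (Sig := Sig) hσ J c]
  -- Overwriting the rows in `J` by 0 does not affect membership in `B`, so `B` is its own preimage
  -- under a map measurable for the rows outside `J`.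
  let r : (ι → ℝ × EuclideanSpace ℝ (Fin k)) → ι → ℝ × EuclideanSpace ℝ (Fin k) :=
    fun z i => if i ∈ J then 0 else z i
  have hr : ∀ z, z ∈ B ↔ r z ∈ B := fun z =>
    ⟨hdep _ _ fun i hi => by simp [r, hi], hdep _ _ fun i hi => by simp [r, hi]⟩
  let m : ι → MeasurableSpace (ι → ℝ × EuclideanSpace ℝ (Fin k)) :=
    fun i => MeasurableSpace.comap (fun z => z i) inferInstance
  have hind : iIndep m (noiseLaw ι σ Sig) :=
    iIndepFun_infinitePi (P := fun _ : ι => rowNoise σ Sig) (X := fun _ x => x)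
      (fun _ => measurable_id)
  have hInd := indep_iSup_of_disjoint (fun i => (measurable_pi_apply i).comap_le) hind
    (disjoint_compl_right (a := (J : Set ι)))
  have hm : ∀ (S : Set ι), ∀ i ∈ S, Measurable[⨆ j ∈ S, m j]
      (fun z : ι → ℝ × EuclideanSpace ℝ (Fin k) => z i) := fun S i hi =>
    (comap_measurable _).mono (le_iSup₂_of_le i hi le_rfl) le_rfl
  rw [Indep_iff] at hInd
  have h1 : MeasurableSet[⨆ j ∈ (J : Set ι), m j]
      {z : ι → ℝ × EuclideanSpace ℝ (Fin k) | ∀ i ∈ J, (z i).1 < c} := by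
    have : {z : ι → ℝ × EuclideanSpace ℝ (Fin k) | ∀ i ∈ J, (z i).1 < c} =
        ⋂ i ∈ J, (fun z => z i) ⁻¹' {x | x.1 < c} := by ext z; simp
    rw [this]
    exact Finset.measurableSet_biInter _ fun i hi =>
      hm J i hi (measurableSet_lt measurable_fst measurable_const)
  have h2 : MeasurableSet[⨆ j ∈ (J : Set ι)ᶜ, m j] B := by
    have hBr : B = r ⁻¹' B := Set.ext hr
    rw [hBr]
    have : Measurable[⨆ j ∈ (J : Set ι)ᶜ, m j] r := by
      refine @measurable_pi_lambda _ _ _ (_) _ r fun i => ?_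
      by_cases hi : i ∈ J
      · simp only [r, hi, if_true]
        exact measurable_const
      · simp only [r, hi, if_false]
        exact hm _ i hi
    exact this hB
  simp only [measureReal_def, hInd _ _ h1 h2, ENNReal.toReal_mul]

end Noise

/-! ### Adding a user -/

section Addition

variable {U ι T : Type*} {Cu k : ℕ}

/-- `X'` arises from `X` by adding a record in the groups of `Jp`, whose count was at least `τ`,
in those of `Je`, whose count was `τ - 1`, and possibly in groups whose count stays below `τ`. The
shift `h` is the effect on the rows in `Jp`. -/
structure Addition (A : Aggregation U ι T k) (τ : ℕ) (X X' : Dataset U ι T Cu) (Jp Je : Finset ι)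
    (h : ι → ℝ × EuclideanSpace ℝ (Fin k)) : Prop where
  disjoint : Disjoint Jp Je
  le_count : ∀ i ∈ Jp, τ ≤ X.count i
  count_eq : ∀ i ∈ Jp, X'.count i = X.count i + 1
  shift_eq : ∀ i ∈ Jp, h i = (1, A i (X'.inGroup i) - A i (X.inGroup i))
  shift_zero : ∀ i ∉ Jp, h i = 0
  count_add_one : ∀ i ∈ Je, X.count i + 1 = τ
  count_edge : ∀ i ∈ Je, X'.count i = τ
  rest : ∀ i ∉ Jp, i ∉ Je → (X.count i < τ ∧ X'.count i < τ) ∨ X'.inGroup i = X.inGroup i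

theorem output_eq_inl_iff (A : Aggregation U ι T k) (τ : ℕ) (τs : ℝ) (X : Dataset U ι T Cu)
    (z : ι → ℝ × EuclideanSpace ℝ (Fin k)) (i : ι) :
    output A τ τs X z i = Sum.inl () ↔ ¬ (τ ≤ X.count i ∧ τs ≤ (X.count i : ℝ) + (z i).1) := by
  unfold output
  split_ifs with h <;> simp [h]

theorem output_congr (A : Aggregation U ι T k) (τ : ℕ) (τs : ℝ) (X : Dataset U ι T Cu)
    {z z' : ι → ℝ × EuclideanSpace ℝ (Fin k)} {i : ι} (h : z i = z' i) :
    output A τ τs X z i = output A τ τs X z' i := by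
  simp only [output, h]

theorem gshm_real_apply (A : Aggregation U ι T k) (τ : ℕ) (τs σ : ℝ)
    (Sig : Matrix (Fin k) (Fin k) ℝ) (X : Dataset U ι T Cu) {S : Set (ι → Row k)}
    (hS : MeasurableSet S) :
    (gshm A τ τs σ Sig X).real S = (noiseLaw ι σ Sig).real (output A τ τs X ⁻¹' S) :=
  map_measureReal_apply (measurable_output A τ τs X) hS

namespace Addition

variable {A : Aggregation U ι T k} {τ : ℕ} {X X' : Dataset U ι T Cu} {Jp Je : Finset ι}
  {h : ι → ℝ × EuclideanSpace ℝ (Fin k)} (H : Addition A τ X X' Jp Je h)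

include H

theorem output_left_edge (τs : ℝ) (z : ι → ℝ × EuclideanSpace ℝ (Fin k)) {i : ι} (hi : i ∈ Je) :
    output A τ τs X z i = Sum.inl () := by
  rw [output_eq_inl_iff]
  have := H.count_add_one i hi
  omega

theorem output_right_edge_iff (τs : ℝ) (z : ι → ℝ × EuclideanSpace ℝ (Fin k)) {i : ι}
    (hi : i ∈ Je) : output A τ τs X' z i = Sum.inl () ↔ (z i).1 < τs - τ := by
  rw [output_eq_inl_iff, H.count_edge i hi]
  simp [lt_sub_iff_add_lt']

/-- On `Jp` the threshold test and the released row depend on data and noise only through their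
sums, so the new record can be charged to the noise. Elsewhere both rows are null or the group is
unchanged. -/
theorem output_right (τs : ℝ) (z : ι → ℝ × EuclideanSpace ℝ (Fin k)) {i : ι} (hi : i ∉ Je) :
    output A τ τs X' z i = output A τ τs X (z + h) i := by
  by_cases hp : i ∈ Jp
  · have h1 := H.le_count i hp
    have h2 := H.count_eq i hp
    have h3 : τ ≤ X.count i + 1 := h1.trans (Nat.le_succ _)
    simp only [output, h2, h1, h3, true_and, Pi.add_apply, H.shift_eq i hp, Prod.fst_add,
      Prod.snd_add, Nat.cast_add, Nat.cast_one]
    have e1 : (X.count i : ℝ) + 1 + (z i).1 = X.count i + ((z i).1 + 1) := by ring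
    have e2 : A i (X'.inGroup i) + (z i).2 = A i (X.inGroup i) +
        ((z i).2 + (A i (X'.inGroup i) - A i (X.inGroup i))) := by abel
    rw [e1, e2]
  · have hz : (z + h) i = z i := by simp [H.shift_zero i hp]
    rcases H.rest i hp hi with ⟨h1, h2⟩ | h1
    · rw [(output_eq_inl_iff A τ τs X' z i).2 (by omega),
        (output_eq_inl_iff A τ τs X (z + h) i).2 (by omega)]
    · have h2 : X'.count i = X.count i := by rw [Dataset.count, Dataset.count, h1]
      simp only [output, h1, h2, hz]

theorem output_right_eq (τs : ℝ) {z : ι → ℝ × EuclideanSpace ℝ (Fin k)}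
    (hz : ∀ i ∈ Je, (z i).1 < τs - τ) : output A τ τs X' z = output A τ τs X (z + h) := by
  ext1 i
  by_cases hi : i ∈ Je
  · rw [H.output_left_edge τs _ hi, H.output_right_edge_iff τs z hi]
    exact hz i hi
  · exact H.output_right τs z hi

/-- On the event that the `Je` rows stay null, `X'` acts as `X` with shifted noise, and the output
on `X` ignores the noise in `Je`; independence yields the product. -/
theorem noiseLaw_inter (τs : ℝ) {σ : ℝ} (hσ : 0 < σ) (Sig : Matrix (Fin k) (Fin k) ℝ)
    {S : Set (ι → Row k)} (hS : MeasurableSet S) :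
    (noiseLaw ι σ Sig).real ({z | ∀ i ∈ Je, (z i).1 < τs - τ} ∩ output A τ τs X' ⁻¹' S) =
      Phi ((τs - τ) / σ) ^ Je.card *
        ((noiseLaw ι σ Sig).map (· + h)).real (output A τ τs X ⁻¹' S) := by
  have hm := measurable_output A τ τs X
  rw [map_measureReal_apply (by fun_prop) (hm hS),
    ← noiseLaw_real_inter hσ Je (τs - τ) ((measurable_add_const h) (hm hS))]
  · congr 1
    ext z
    refine and_congr_right fun hz => ?_
    change output A τ τs X' z ∈ S ↔ output A τ τs X (z + h) ∈ S
    rw [H.output_right_eq τs hz]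
  · intro z z' hzz hz
    have : output A τ τs X (z + h) = output A τ τs X (z' + h) := by
      ext1 i
      by_cases hi : i ∈ Je
      · rw [H.output_left_edge τs _ hi, H.output_left_edge τs _ hi]
      · exact output_congr A τ τs X (by simp [hzz i hi])
    change output A τ τs X (z' + h) ∈ S
    rw [← this]
    exact hz

theorem le_gshm_real (τs : ℝ) {σ : ℝ} (hσ : 0 < σ) (Sig : Matrix (Fin k) (Fin k) ℝ)
    {S : Set (ι → Row k)} (hS : MeasurableSet S) :
    Phi ((τs - τ) / σ) ^ Je.card *
        ((noiseLaw ι σ Sig).map (· + h)).real (output A τ τs X ⁻¹' S) ≤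
      (gshm A τ τs σ Sig X').real S := by
  rw [← H.noiseLaw_inter τs hσ Sig hS, gshm_real_apply A τ τs σ Sig X' hS]
  exact measureReal_mono Set.inter_subset_right

theorem gshm_real_le (τs : ℝ) {σ : ℝ} (hσ : 0 < σ) (Sig : Matrix (Fin k) (Fin k) ℝ)
    {S : Set (ι → Row k)} (hS : MeasurableSet S) :
    (gshm A τ τs σ Sig X').real S ≤ Phi ((τs - τ) / σ) ^ Je.card *
        ((noiseLaw ι σ Sig).map (· + h)).real (output A τ τs X ⁻¹' S) +
      (1 - Phi ((τs - τ) / σ) ^ Je.card) := by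
  have hE : MeasurableSet {z : ι → ℝ × EuclideanSpace ℝ (Fin k) | ∀ i ∈ Je, (z i).1 < τs - τ} := by
    have : {z : ι → ℝ × EuclideanSpace ℝ (Fin k) | ∀ i ∈ Je, (z i).1 < τs - τ} =
        ⋂ i ∈ Je, {z | (z i).1 < τs - τ} := by ext z; simp
    rw [this]
    exact Finset.measurableSet_biInter _ fun i _ => measurableSet_lt (by fun_prop) measurable_const
  rw [← H.noiseLaw_inter τs hσ Sig hS, gshm_real_apply A τ τs σ Sig X' hS,
    ← noiseLaw_real_forall_lt (Sig := Sig) hσ Je, ← probReal_compl_eq_one_sub hE]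
  refine (measureReal_mono fun z hz => ?_).trans (measureReal_union_le _ _)
  by_cases h : z ∈ {z : ι → ℝ × EuclideanSpace ℝ (Fin k) | ∀ i ∈ Je, (z i).1 < τs - τ}
  · exact Or.inl ⟨h, hz⟩
  · exact Or.inr h

end Addition

/-! ### Privacy -/

-- The groups of the added user are sorted by their old count: at least τ, exactly τ - 1, or less.
-- The last kind lies in neither set, hence only an inequality for the cardinalities.
open Classical in
theorem exists_addition_of_isRemoval (A : Aggregation U ι T k) (τ : ℕ) {X X' : Dataset U ι T Cu}
    (hX : IsRemoval X X') :
    ∃ (Jp Je : Finset ι) (h : ι → ℝ × EuclideanSpace ℝ (Fin k)),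
      Addition A τ X X' Jp Je h ∧ Jp.card + Je.card ≤ Cu := by
  obtain ⟨u, hu⟩ := hX
  let J : Finset ι := (X'.records.filter fun r => r.user = u).image Record.group
  have hJ : J.card ≤ Cu := Finset.card_image_le.trans (by convert X'.bounded u)
  have hin : ∀ i ∉ J, X'.inGroup i = X.inGroup i := by
    intro i hi
    ext r
    simp only [Dataset.inGroup, hu, Finset.mem_filter]
    constructor
    · rintro ⟨h1, h2⟩
      exact ⟨⟨h1, fun h3 => hi (Finset.mem_image.2 ⟨r, Finset.mem_filter.2 ⟨h1, h3⟩, h2⟩)⟩, h2⟩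
    · rintro ⟨⟨h1, _⟩, h2⟩
      exact ⟨h1, h2⟩
  have hcount : ∀ i ∈ J, X'.count i = X.count i + 1 := by
    intro i hi
    obtain ⟨r, hr, hri⟩ := Finset.mem_image.1 hi
    obtain ⟨hr, hru⟩ := Finset.mem_filter.1 hr
    have : X'.inGroup i = insert r (X.inGroup i) := by
      ext s
      simp only [Dataset.inGroup, hu, Finset.mem_filter, Finset.mem_insert]
      constructor
      · rintro ⟨h1, h2⟩
        by_cases h3 : s.user = u
        · exact Or.inl (X'.unique s h1 r hr (h3.trans hru.symm) (h2.trans hri.symm))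
        · exact Or.inr ⟨⟨h1, h3⟩, h2⟩
      · rintro (rfl | ⟨⟨h1, _⟩, h2⟩)
        · exact ⟨hr, hri⟩
        · exact ⟨h1, h2⟩
    rw [Dataset.count, this, Finset.card_insert_of_notMem, Dataset.count]
    simp [Dataset.inGroup, hu, hru]
  refine ⟨J.filter fun i => τ ≤ X.count i, J.filter fun i => X.count i + 1 = τ,
    fun i => if i ∈ J.filter fun i => τ ≤ X.count i then
      (1, A i (X'.inGroup i) - A i (X.inGroup i)) else 0, ⟨?_, ?_, ?_, ?_, ?_, ?_, ?_, ?_⟩, ?_⟩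
  · rw [Finset.disjoint_filter]
    intro i _ h1 h2
    omega
  · exact fun i hi => (Finset.mem_filter.1 hi).2
  · exact fun i hi => hcount i (Finset.mem_filter.1 hi).1
  · exact fun i hi => if_pos hi
  · exact fun i hi => if_neg hi
  · exact fun i hi => (Finset.mem_filter.1 hi).2
  · intro i hi
    obtain ⟨h1, h2⟩ := Finset.mem_filter.1 hi
    rw [hcount i h1, h2]
  · intro i h1 h2
    by_cases hi : i ∈ J
    · left
      simp only [Finset.mem_filter, hi, true_and] at h1 h2
      have := hcount i hi
      omega
    · exact Or.inr (hin i hi)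
  · rw [← Finset.card_union_of_disjoint]
    · exact (Finset.card_le_card (Finset.union_subset (Finset.filter_subset _ _)
        (Finset.filter_subset _ _))).trans hJ
    · rw [Finset.disjoint_filter]
      intro i _ h1 h2
      omega

/-! ### The three terms of the bound and the rescaled ε₂, ε₃ -/

section Accounting

variable {τ : ℕ} {τs σ μo ε δ : ℝ} {hCu : 1 ≤ Cu}

theorem one_sub_pow_le_gshmDelta :
    1 - Phi ((τs - τ) / σ) ^ Cu ≤ gshmDelta Cu hCu τ τs σ μo ε :=
  le_max_left _ _

theorem eps2_le_gshmDelta {p : ℕ × ℕ} (hp : p ∈ splits Cu) :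
    1 - Phi ((τs - τ) / σ) ^ p.2 +
        Phi ((τs - τ) / σ) ^ p.2 * analyticGaussian (muPlus σ μo p.1) (eps2 τ τs σ ε p.2) ≤
      gshmDelta Cu hCu τ τs σ μo ε :=
  (Finset.le_sup' (fun p : ℕ × ℕ => 1 - Phi ((τs - τ) / σ) ^ p.2 +
        Phi ((τs - τ) / σ) ^ p.2 * analyticGaussian (muPlus σ μo p.1) (eps2 τ τs σ ε p.2))
    hp).trans ((le_max_left _ _).trans (le_max_right _ _))

theorem eps3_le_gshmDelta {p : ℕ × ℕ} (hp : p ∈ splits Cu) :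
    analyticGaussian (muPlus σ μo p.1) (eps3 τ τs σ ε p.2) ≤ gshmDelta Cu hCu τ τs σ μo ε :=
  (Finset.le_sup' (fun p : ℕ × ℕ => analyticGaussian (muPlus σ μo p.1) (eps3 τ τs σ ε p.2))
    hp).trans ((le_max_right _ _).trans (le_max_right _ _))

theorem gshmDelta_le (h1 : 1 - Phi ((τs - τ) / σ) ^ Cu ≤ δ)
    (h2 : ∀ p ∈ splits Cu, 1 - Phi ((τs - τ) / σ) ^ p.2 +
        Phi ((τs - τ) / σ) ^ p.2 * analyticGaussian (muPlus σ μo p.1) (eps2 τ τs σ ε p.2) ≤ δ)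
    (h3 : ∀ p ∈ splits Cu, analyticGaussian (muPlus σ μo p.1) (eps3 τ τs σ ε p.2) ≤ δ) :
    gshmDelta Cu hCu τ τs σ μo ε ≤ δ :=
  max_le h1 (max_le (Finset.sup'_le _ _ h2) (Finset.sup'_le _ _ h3))

theorem pow_mul_exp_eps2 (a : ℕ) :
    Phi ((τs - τ) / σ) ^ a * Real.exp (eps2 τ τs σ ε a) = Real.exp ε := by
  rw [eps2, Real.exp_sub, Real.exp_nat_mul, Real.exp_log (Phi_pos _)]
  have := Phi_pos ((τs - τ) / σ)
  field_simp

theorem exp_eps3 (a : ℕ) :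
    Real.exp (eps3 τ τs σ ε a) = Real.exp ε * Phi ((τs - τ) / σ) ^ a := by
  rw [eps3, Real.exp_add, Real.exp_nat_mul, Real.exp_log (Phi_pos _)]

end Accounting

/-- Every row of `Jp` contributes at most 1/σ² + μₒ², and monotonicity lets the unused part of the
budget C_u count towards a₊. -/
theorem Addition.analyticGaussian_le {A : Aggregation U ι T k} {τ : ℕ} {X X' : Dataset U ι T Cu}
    {Jp Je : Finset ι} {h : ι → ℝ × EuclideanSpace ℝ (Fin k)} (H : Addition A τ X X' Jp Je h)
    (hn : Neighbors X' X) (hcard : Jp.card + Je.card ≤ Cu) (hp : Jp.Nonempty) {σ : ℝ} (hσ : 0 < σ)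
    {Sig : Matrix (Fin k) (Fin k) ℝ} (hSig : Sig.PosDef) {μo : ℝ}
    (hA : μo ^ 2 ∈ upperBounds (sensitivitySet Cu A Sig)) (ε : ℝ) :
    (∑ i ∈ Jp, Real.toNNReal (rowSq σ Sig (h i)) ≠ 0) ∧
      analyticGaussian (Real.sqrt (∑ i ∈ Jp, Real.toNNReal (rowSq σ Sig (h i)) : ℝ≥0)) ε ≤
        analyticGaussian (muPlus σ μo (Cu - Je.card)) ε := by
  have hrow : ∀ i ∈ Jp, 0 < rowSq σ Sig (h i) ∧ rowSq σ Sig (h i) ≤ 1 / σ ^ 2 + μo ^ 2 := by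
    intro i hi
    rw [H.shift_eq i hi, rowSq, one_pow]
    refine ⟨add_pos_of_pos_of_nonneg (by positivity) (dotProduct_inv_mulVec_nonneg hSig _), ?_⟩
    gcongr
    exact hA ⟨i, X', X, hn, rfl⟩
  have hpos : 0 < ∑ i ∈ Jp, Real.toNNReal (rowSq σ Sig (h i)) :=
    Finset.sum_pos (fun i hi => Real.toNNReal_pos.2 (hrow i hi).1) hp
  refine ⟨hpos.ne', analyticGaussian_mono (Real.sqrt_pos.2 (by exact_mod_cast hpos)) ?_ ε⟩
  refine Real.sqrt_le_sqrt ?_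
  rw [NNReal.coe_sum]
  calc ∑ i ∈ Jp, (Real.toNNReal (rowSq σ Sig (h i)) : ℝ)
      ≤ ∑ i ∈ Jp, (1 / σ ^ 2 + μo ^ 2) := Finset.sum_le_sum fun i hi => by
        rw [Real.coe_toNNReal _ (hrow i hi).1.le]; exact (hrow i hi).2
    _ = Jp.card * (1 / σ ^ 2 + μo ^ 2) := by rw [Finset.sum_const, nsmul_eq_mul]
    _ ≤ ((Cu - Je.card : ℕ) : ℝ) * (1 / σ ^ 2 + μo ^ 2) := by
        gcongr
        omega
    _ = _ := by ring

theorem isDP_gshm (hCu : 1 ≤ Cu) {A : Aggregation U ι T k} {τ : ℕ} {τs σ : ℝ} (hσ : 0 < σ)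
    {Sig : Matrix (Fin k) (Fin k) ℝ} (hSig : Sig.PosDef) {μo : ℝ}
    (hA : μo ^ 2 ∈ upperBounds (sensitivitySet Cu A Sig)) {ε δ : ℝ} (hε : 0 ≤ ε)
    (hD : gshmDelta Cu hCu τ τs σ μo ε ≤ δ) :
    IsDP (Neighbors (U := U) (ι := ι) (T := T) (Cu := Cu)) (gshm A τ τs σ Sig) ε δ := by
  have key : ∀ X X' : Dataset U ι T Cu, IsRemoval X X' → ∀ S : Set (ι → Row k), MeasurableSet S →
      (gshm A τ τs σ Sig X).real S ≤ Real.exp ε * (gshm A τ τs σ Sig X').real S + δ ∧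
      (gshm A τ τs σ Sig X').real S ≤ Real.exp ε * (gshm A τ τs σ Sig X).real S + δ := by
    intro X X' hX S hS
    obtain ⟨Jp, Je, h, H, hcard⟩ := exists_addition_of_isRemoval A τ hX
    have hlow := H.le_gshm_real τs hσ Sig hS
    have hup := H.gshm_real_le τs hσ Sig hS
    have hXS := gshm_real_apply A τ τs σ Sig X hS
    have hB : MeasurableSet (output A τ τs X ⁻¹' S) := measurable_output A τ τs X hS
    set B := output A τ τs X ⁻¹' S
    have hLR := gaussLR_noiseLaw hσ hSig Jp h H.shift_zero
    have : IsProbabilityMeasure ((noiseLaw ι σ Sig).map (· + h)) :=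
      Measure.isProbabilityMeasure_map (by fun_prop)
    have hβ := Phi_pos ((τs - τ) / σ)
    have hβ1 := Phi_le_one ((τs - τ) / σ)
    have hβa : 0 < Phi ((τs - τ) / σ) ^ Je.card := by positivity
    have hε1 : 1 ≤ Real.exp ε := Real.one_le_exp hε
    rw [hXS]
    rcases Jp.eq_empty_or_nonempty with rfl | hp
    · have h0 : h = 0 := funext fun i => H.shift_zero i (Finset.notMem_empty i)
      have hid : (noiseLaw ι σ Sig).map (· + h) = noiseLaw ι σ Sig := by
        simp [h0]
      rw [hid] at hlow hup
      -- Without a shift, only the mass 1 - β^a₌ of visible `Je` rows separates the two laws.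
      have h1 : 1 - Phi ((τs - τ) / σ) ^ Je.card ≤ δ := by
        refine le_trans ?_ (one_sub_pow_le_gshmDelta.trans hD)
        have := pow_le_pow_of_le_one hβ.le hβ1 (show Je.card ≤ Cu by omega)
        linarith
      have hb0 : 0 ≤ (noiseLaw ι σ Sig).real B := measureReal_nonneg
      have hb1 : (noiseLaw ι σ Sig).real B ≤ 1 := measureReal_le_one
      have hβa1 : Phi ((τs - τ) / σ) ^ Je.card ≤ 1 := pow_le_one₀ hβ.le hβ1
      have hX0 : 0 ≤ (gshm A τ τs σ Sig X').real S := measureReal_nonneg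
      constructor <;> nlinarith
    · have hmem : (Cu - Je.card, Je.card) ∈ splits Cu := by
        have := hp.card_pos
        rw [splits, Finset.mem_filter]
        exact ⟨Finset.HasAntidiagonal.mem_antidiagonal.2 (by dsimp only; omega),
          by dsimp only; omega⟩
      have hn : Neighbors X' X := Or.inr hX
      constructor
      -- From `X` to `X'` the shifted law is on the right, so the reversed ratio is used, and the
      -- weight β^a₌ turns `exp ε` into `exp ε₃`.
      · obtain ⟨hq, hle⟩ := H.analyticGaussian_le hn hcard hp hσ hSig hA
          (eps3 τ τs σ ε Je.card)
        have h1 := hLR.symm.real_sub_le hq (eps3 τ τs σ ε Je.card) hB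
        have h2 := (eps3_le_gshmDelta (ε := ε) (hCu := hCu) hmem).trans hD
        rw [exp_eps3] at h1
        have h3 := mul_le_mul_of_nonneg_left hlow (Real.exp_nonneg ε)
        dsimp only at h2
        linarith
      · obtain ⟨hq, hle⟩ := H.analyticGaussian_le hn hcard hp hσ hSig hA
          (eps2 τ τs σ ε Je.card)
        have h1 := hLR.real_sub_le hq (eps2 τ τs σ ε Je.card) hB
        have h2 := (eps2_le_gshmDelta (ε := ε) (hCu := hCu) hmem).trans hD
        have h3 := mul_le_mul_of_nonneg_left (h1.trans hle) hβa.le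
        rw [mul_sub, ← mul_assoc, pow_mul_exp_eps2] at h3
        dsimp only at h2
        linarith
  intro X X' hX S hS
  rcases hX with hX | hX
  · exact (key X X' hX S hS).1
  · exact (key X' X hX S hS).2

end Addition

variable {U ι T : Type*} {Cu k : ℕ}

/-! ### Optimal tests -/

section Tests

/-- The noise that explains the output `y` on the dataset `X`, in the non-null rows of `y`. -/
def recoverNoise (A : Aggregation U ι T k) (X : Dataset U ι T Cu) (y : ι → Row k) :
    ι → ℝ × EuclideanSpace ℝ (Fin k) := fun i =>
  Sum.elim (fun _ => 0) (fun p => p - ((X.count i : ℝ), A i (X.inGroup i))) (y i)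

theorem measurable_recoverNoise (A : Aggregation U ι T k) (X : Dataset U ι T Cu) :
    Measurable (recoverNoise A X) :=
  measurable_pi_lambda _ fun i => (Measurable.sumElim measurable_const
    (measurable_id.sub measurable_const)).comp (measurable_pi_apply i)

/-- The outputs in which no row of `J` is null and the recovered noise is in `H`. -/
def testSet (A : Aggregation U ι T k) (X : Dataset U ι T Cu) (J : Finset ι)
    (H : Set (ι → ℝ × EuclideanSpace ℝ (Fin k))) : Set (ι → Row k) :=
  {y | (∀ i ∈ J, y i ≠ Sum.inl ()) ∧ recoverNoise A X y ∈ H}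

theorem measurableSet_forall_eq_inl (J : Finset ι) :
    MeasurableSet {y : ι → Row k | ∀ i ∈ J, y i = Sum.inl ()} := by
  have : {y : ι → Row k | ∀ i ∈ J, y i = Sum.inl ()} =
      ⋂ i ∈ J, (fun y => y i) ⁻¹' Set.range Sum.inl := by
    ext y
    simp [eq_comm, Unique.exists_iff]
  rw [this]
  exact Finset.measurableSet_biInter _ fun i _ =>
    measurable_pi_apply i measurableSet_range_inl

theorem measurableSet_testSet (A : Aggregation U ι T k) (X : Dataset U ι T Cu) (J : Finset ι)
    {H : Set (ι → ℝ × EuclideanSpace ℝ (Fin k))} (hH : MeasurableSet H) :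
    MeasurableSet (testSet A X J H) := by
  have : testSet A X J H =
      (⋂ i ∈ J, {y : ι → Row k | ∀ j ∈ ({i} : Finset ι), y j = Sum.inl ()}ᶜ) ∩
        recoverNoise A X ⁻¹' H := by
    ext y
    simp [testSet]
  rw [this]
  exact (Finset.measurableSet_biInter _ fun i _ => (measurableSet_forall_eq_inl _).compl).inter
    (measurable_recoverNoise A X hH)

theorem recoverNoise_output {A : Aggregation U ι T k} {τ : ℕ} {τs : ℝ} {X : Dataset U ι T Cu}
    {z : ι → ℝ × EuclideanSpace ℝ (Fin k)} {i : ι} (h : output A τ τs X z i ≠ Sum.inl ()) :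
    recoverNoise A X (output A τ τs X z) i = z i := by
  rw [Ne, output_eq_inl_iff, not_not] at h
  simp [recoverNoise, output, h]

/-- Membership in `H` only depends on the rows in `J`. -/
def DependsOnRows {α : Type*} (J : Finset ι) (H : Set (ι → α)) : Prop :=
  ∀ z z' : ι → α, (∀ i ∈ J, z i = z' i) → z ∈ H → z' ∈ H

theorem preimage_testSet_subset {A : Aggregation U ι T k} {τ : ℕ} {τs : ℝ} {X : Dataset U ι T Cu}
    {J : Finset ι} {H : Set (ι → ℝ × EuclideanSpace ℝ (Fin k))} (hH : DependsOnRows J H) :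
    output A τ τs X ⁻¹' testSet A X J H ⊆ H := fun _ hz =>
  hH _ _ (fun i hi => recoverNoise_output (hz.1 i hi)) hz.2

/-- A row with count `n` is hidden only when its noise is below τ* - n. Otherwise the noise is
recovered exactly, so up to this event the output supports every test on the noise. -/
theorem subset_preimage_testSet_union {A : Aggregation U ι T k} {τ : ℕ} {τs : ℝ}
    {X : Dataset U ι T Cu} {J : Finset ι} {H : Set (ι → ℝ × EuclideanSpace ℝ (Fin k))}
    (hH : DependsOnRows J H) {n : ℕ} (hn : τ ≤ n) (hX : ∀ i ∈ J, X.count i = n) :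
    H ⊆ output A τ τs X ⁻¹' testSet A X J H ∪ {z | ∃ i ∈ J, (z i).1 < τs - n} := by
  intro z hz
  by_cases hb : ∃ i ∈ J, (z i).1 < τs - n
  · exact Or.inr hb
  · push Not at hb
    have hne : ∀ i ∈ J, output A τ τs X z i ≠ Sum.inl () := fun i hi => by
      rw [Ne, output_eq_inl_iff, not_not, hX i hi]
      exact ⟨hn, by linarith [hb i hi]⟩
    exact Or.inl ⟨hne, hH _ _ (fun i hi => (recoverNoise_output (hne i hi)).symm) hz⟩

theorem dependsOnRows_region (σ : ℝ) (Sig : Matrix (Fin k) (Fin k) ℝ) (J : Finset ι)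
    (h : ι → ℝ × EuclideanSpace ℝ (Fin k)) (q : ℝ≥0) (ε : ℝ) :
    DependsOnRows J (GaussLR.region q (noiseLLR σ Sig J h) ε) ∧
      DependsOnRows J (GaussLR.region q (fun z => q - noiseLLR σ Sig J h z) ε) := by
  have : ∀ z z' : ι → ℝ × EuclideanSpace ℝ (Fin k), (∀ i ∈ J, z i = z' i) →
      noiseLLR σ Sig J h z = noiseLLR σ Sig J h z' := fun z z' hz =>
    Finset.sum_congr rfl fun i hi => by rw [hz i hi]
  constructor <;> intro z z' hz hmem <;> simpa [GaussLR.region, this z z' hz] using hmem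

end Tests

namespace Addition

variable {A : Aggregation U ι T k} {τ : ℕ} {X X' : Dataset U ι T Cu} {Jp Je : Finset ι}
  {h : ι → ℝ × EuclideanSpace ℝ (Fin k)} (H : Addition A τ X X' Jp Je h)

include H

/-- A test may also require that all rows in `Je` are null. -/
theorem real_le_of_forall_le {τs σ ε δ : ℝ} (hσ : 0 < σ) (Sig : Matrix (Fin k) (Fin k) ℝ)
    (hDP : ∀ S : Set (ι → Row k), MeasurableSet S →
      (gshm A τ τs σ Sig X).real S ≤ Real.exp ε * (gshm A τ τs σ Sig X').real S + δ)
    {S : Set (ι → Row k)} (hS : MeasurableSet S) :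
    (noiseLaw ι σ Sig).real (output A τ τs X ⁻¹' S) ≤
      Real.exp ε * (Phi ((τs - τ) / σ) ^ Je.card *
        ((noiseLaw ι σ Sig).map (· + h)).real (output A τ τs X ⁻¹' S)) + δ := by
  have hm := hS.inter (measurableSet_forall_eq_inl (k := k) Je)
  have := hDP _ hm
  rw [gshm_real_apply A τ τs σ Sig X hm, gshm_real_apply A τ τs σ Sig X' hm] at this
  -- Requiring null `Je` rows costs nothing on `X`, but an independent factor β per row on `X'`.
  have h1 : output A τ τs X ⁻¹' (S ∩ {y | ∀ i ∈ Je, y i = Sum.inl ()}) =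
      output A τ τs X ⁻¹' S :=
    Set.ext fun z => and_iff_left fun i hi => H.output_left_edge τs z hi
  have h2 : output A τ τs X' ⁻¹' (S ∩ {y | ∀ i ∈ Je, y i = Sum.inl ()}) =
      {z | ∀ i ∈ Je, (z i).1 < τs - τ} ∩ output A τ τs X' ⁻¹' S :=
    Set.ext fun z => and_comm.trans
      (and_congr_left fun _ => forall₂_congr fun i hi => H.output_right_edge_iff τs z hi)
  rwa [h1, h2, H.noiseLaw_inter τs hσ Sig hS] at this

/-- A test may also accept when some row in `Je` is not null. -/
theorem le_real_of_forall_le {τs σ ε δ : ℝ} (hσ : 0 < σ) (Sig : Matrix (Fin k) (Fin k) ℝ)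
    (hDP : ∀ S : Set (ι → Row k), MeasurableSet S →
      (gshm A τ τs σ Sig X').real S ≤ Real.exp ε * (gshm A τ τs σ Sig X).real S + δ)
    {S : Set (ι → Row k)} (hS : MeasurableSet S) :
    1 - Phi ((τs - τ) / σ) ^ Je.card + Phi ((τs - τ) / σ) ^ Je.card *
        ((noiseLaw ι σ Sig).map (· + h)).real (output A τ τs X ⁻¹' S) ≤
      Real.exp ε * (noiseLaw ι σ Sig).real (output A τ τs X ⁻¹' S) + δ := by
  have hm := hS.union (measurableSet_forall_eq_inl (k := k) Je).compl
  have := hDP _ hm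
  rw [gshm_real_apply A τ τs σ Sig X hm, gshm_real_apply A τ τs σ Sig X' hm] at this
  have h1 : output A τ τs X ⁻¹' (S ∪ {y | ∀ i ∈ Je, y i = Sum.inl ()}ᶜ) =
      output A τ τs X ⁻¹' S := by
    ext z
    simp only [Set.mem_preimage, Set.mem_union, Set.mem_compl_iff, Set.mem_ofPred_eq,
      or_iff_left_iff_imp, not_forall]
    rintro ⟨i, hi, hne⟩
    exact absurd (H.output_left_edge τs z hi) hne
  have hEq : output A τ τs X' ⁻¹' {y | ∀ i ∈ Je, y i = Sum.inl ()} =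
      {z | ∀ i ∈ Je, (z i).1 < τs - τ} := by
    ext z
    exact forall₂_congr fun i hi => H.output_right_edge_iff τs z hi
  have hE : MeasurableSet {z : ι → ℝ × EuclideanSpace ℝ (Fin k) | ∀ i ∈ Je, (z i).1 < τs - τ} := by
    rw [← hEq]
    exact measurable_output A τ τs X' (measurableSet_forall_eq_inl Je)
  have h2 : output A τ τs X' ⁻¹' (S ∪ {y | ∀ i ∈ Je, y i = Sum.inl ()}ᶜ) =
      {z | ∀ i ∈ Je, (z i).1 < τs - τ}ᶜ ∪
        ({z | ∀ i ∈ Je, (z i).1 < τs - τ} ∩ output A τ τs X' ⁻¹' S) := by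
    rw [Set.preimage_union, Set.preimage_compl, hEq, Set.union_inter_distrib_left,
      Set.compl_union_self, Set.univ_inter, Set.union_comm]
  rw [h1, h2, measureReal_union (disjoint_compl_left.mono_right Set.inter_subset_left)
    (hE.inter (measurable_output A τ τs X' hS)), probReal_compl_eq_one_sub hE,
    noiseLaw_real_forall_lt hσ, H.noiseLaw_inter τs hσ Sig hS] at this
  exact this

end Addition

/-! ### Extremal datasets -/

section Grid

open Classical in
/-- The dataset in which the users `e j`, `j ∈ c p`, have a record in group `g p`. -/
def gridDataset (e : ℕ ↪ U) (g : Fin Cu ↪ ι) (t : T) (c : Fin Cu → Finset ℕ) :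
    Dataset U ι T Cu where
  records := (Finset.univ.sigma c).image fun p => ⟨e p.2, g p.1, t⟩
  unique := by
    intro r hr s hs hu hg
    obtain ⟨p, _, rfl⟩ := Finset.mem_image.1 hr
    obtain ⟨p', _, rfl⟩ := Finset.mem_image.1 hs
    simp_all
  bounded := by
    intro u
    have : ((Finset.univ.sigma c).image fun p => (⟨e p.2, g p.1, t⟩ : Record U ι T)).filter
        (fun r => r.user = u) ⊆ Finset.univ.image fun p : Fin Cu => ⟨u, g p, t⟩ := by
      intro r hr
      obtain ⟨hr, hu⟩ := Finset.mem_filter.1 hr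
      obtain ⟨p, _, rfl⟩ := Finset.mem_image.1 hr
      exact Finset.mem_image.2 ⟨p.1, Finset.mem_univ _, by rw [← hu]⟩
    refine (Finset.card_le_card this).trans (Finset.card_image_le.trans ?_)
    simp

variable (e : ℕ ↪ U) (g : Fin Cu ↪ ι) (t : T) (c : Fin Cu → Finset ℕ)

theorem gridDataset_count (p : Fin Cu) : (gridDataset e g t c).count (g p) = (c p).card := by
  classical
  have : (gridDataset e g t c).inGroup (g p) = (c p).image fun j => ⟨e j, g p, t⟩ := by
    ext r
    simp only [Dataset.inGroup, gridDataset, Finset.mem_filter, Finset.mem_image,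
      Finset.mem_sigma, Finset.mem_univ, true_and]
    constructor
    · rintro ⟨⟨⟨p', j⟩, hj, rfl⟩, hg⟩
      obtain rfl : p' = p := g.injective hg
      exact ⟨j, hj, rfl⟩
    · rintro ⟨j, hj, rfl⟩
      exact ⟨⟨⟨p, j⟩, hj, rfl⟩, rfl⟩
  rw [Dataset.count, this, Finset.card_image_of_injective]
  intro j j' hj
  simpa using hj

theorem gridDataset_inGroup_of_notMem {i : ι} (hi : i ∉ Set.range g) :
    (gridDataset e g t c).inGroup i = ∅ := by
  classical
  refine Finset.eq_empty_of_forall_notMem fun r hr => hi ?_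
  simp only [Dataset.inGroup, gridDataset, Finset.mem_filter, Finset.mem_image,
    Finset.mem_sigma, Finset.mem_univ, true_and] at hr
  obtain ⟨⟨p, _, rfl⟩, hg⟩ := hr
  exact ⟨p.1, hg⟩

/-- The added user is `e 0`, who joins all C_u groups at once. -/
theorem gridDataset_neighbors (m : Fin Cu → ℕ) :
    Neighbors (gridDataset e g t fun p => Finset.Icc 1 (m p))
      (gridDataset e g t fun p => Finset.range (m p + 1)) := by
  classical
  refine Or.inl ⟨e 0, ?_⟩
  ext r
  simp only [gridDataset, Finset.mem_filter, Finset.mem_image,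
    Finset.mem_sigma, Finset.mem_univ, true_and, Finset.mem_Icc, Finset.mem_range]
  constructor
  · rintro ⟨p, hp, rfl⟩
    exact ⟨⟨p, by omega, rfl⟩, fun h0 => by have := e.injective h0; omega⟩
  · rintro ⟨⟨p, hp, rfl⟩, hne⟩
    have : p.2 ≠ 0 := fun h0 => hne (by rw [h0])
    exact ⟨p, by omega, rfl⟩

end Grid

/-- The aggregation function that sums the vector `w` over the records. -/
def sumAggregation (U ι T : Type*) {k : ℕ} (w : EuclideanSpace ℝ (Fin k)) : Aggregation U ι T k :=
  fun _ S => (S.card : ℝ) • w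

open Matrix in
theorem isGreatest_sensitivitySet_sumAggregation (hCu : 1 ≤ Cu) (e : ℕ ↪ U) (g : Fin Cu ↪ ι) (t : T)
    {Sig : Matrix (Fin k) (Fin k) ℝ} {μo : ℝ} {w : EuclideanSpace ℝ (Fin k)}
    (hw : w.ofLp ⬝ᵥ Sig⁻¹ *ᵥ w.ofLp = μo ^ 2) :
    IsGreatest (sensitivitySet Cu (sumAggregation U ι T w) Sig) (μo ^ 2) := by
  have hquad : ∀ s : ℝ, (s • w).ofLp ⬝ᵥ Sig⁻¹ *ᵥ (s • w).ofLp = s ^ 2 * μo ^ 2 := fun s => by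
    rw [WithLp.ofLp_smul, mulVec_smul, smul_dotProduct, dotProduct_smul, hw]
    simp only [smul_eq_mul]
    ring
  have hdiff : ∀ (X X' : Dataset U ι T Cu) (i : ι), sumAggregation U ι T w i (X.inGroup i) -
      sumAggregation U ι T w i (X'.inGroup i) = ((X.count i : ℝ) - X'.count i) • w :=
    fun X X' i => (sub_smul _ _ _).symm
  have hcount : ∀ X X' : Dataset U ι T Cu, IsRemoval X X' → ∀ i,
      ((X.count i : ℝ) - X'.count i) ^ 2 ≤ 1 := by
    intro X X' hX i
    -- With threshold 0 no count lies below it and `Je` is empty, so each group either gains one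
    -- record or is unchanged.
    obtain ⟨Jp, Je, h, H, _⟩ := exists_addition_of_isRemoval (sumAggregation U ι T w) 0 hX
    by_cases hp : i ∈ Jp
    · rw [H.count_eq i hp]
      simp
    · have he : i ∉ Je := fun he => by simpa using H.count_add_one i he
      rcases H.rest i hp he with h | h
      · omega
      · simp [Dataset.count, h]
  constructor
  · refine ⟨g ⟨0, hCu⟩, _, _, gridDataset_neighbors e g t fun _ => 0, ?_⟩
    rw [hdiff, hquad, gridDataset_count, gridDataset_count]
    simp
  · rintro _ ⟨i, X, X', hX, rfl⟩
    rw [hdiff, hquad]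
    refine mul_le_of_le_one_left (sq_nonneg _) ?_
    rcases hX with hX | hX
    · exact hcount X X' hX i
    · rw [← neg_sub, neg_sq]
      exact hcount X' X hX i

open Classical in
theorem exists_addition_sumAggregation (e : ℕ ↪ U) (g : Fin Cu ↪ ι) (t : T)
    (w : EuclideanSpace ℝ (Fin k)) {τ : ℕ} (hτ : 1 ≤ τ) {a b : ℕ} (hab : a + b = Cu) {n : ℕ}
    (hn : τ ≤ n) :
    ∃ (X X' : Dataset U ι T Cu) (Jp Je : Finset ι), Neighbors X X' ∧
      Addition (sumAggregation U ι T w) τ X X' Jp Je (fun i => if i ∈ Jp then (1, w) else 0) ∧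
      Jp.card = a ∧ Je.card = b ∧ ∀ i ∈ Jp, X.count i = n := by
  let P : Finset (Fin Cu) := Finset.univ.filter fun p => (p : ℕ) < a
  have hP : P.card = a := by
    rw [Fin.card_filter_val_lt]
    omega
  -- The groups outside `P` sit just below the threshold, so the added user lifts each to τ; `hτ`
  -- makes the natural subtraction genuine.
  let m : Fin Cu → ℕ := fun p => if p ∈ P then n else τ - 1
  have hX : ∀ p, (gridDataset e g t fun p => Finset.Icc 1 (m p)).count (g p) = m p := fun p => by
    rw [gridDataset_count]; simp
  have hX' : ∀ p, (gridDataset e g t fun p => Finset.range (m p + 1)).count (g p) = m p + 1 :=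
    fun p => by rw [gridDataset_count]; simp
  have hmP : ∀ p ∈ P, m p = n := fun p hp => if_pos hp
  have hmP' : ∀ p ∈ Pᶜ, m p = τ - 1 := fun p hp => if_neg (Finset.mem_compl.1 hp)
  refine ⟨gridDataset e g t fun p => Finset.Icc 1 (m p),
    gridDataset e g t fun p => Finset.range (m p + 1), P.map g, Pᶜ.map g,
    gridDataset_neighbors e g t m, ⟨?_, ?_, ?_, ?_, ?_, ?_, ?_, ?_⟩, ?_, ?_, ?_⟩
  · exact (Finset.disjoint_map g).2 disjoint_compl_right
  · intro i hi
    obtain ⟨p, hp, rfl⟩ := Finset.mem_map.1 hi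
    rw [hX, hmP p hp]
    exact hn
  · intro i hi
    obtain ⟨p, hp, rfl⟩ := Finset.mem_map.1 hi
    rw [hX, hX']
  · intro i hi
    rw [if_pos hi]
    obtain ⟨p, hp, rfl⟩ := Finset.mem_map.1 hi
    have h1 := hX p
    have h2 := hX' p
    rw [Dataset.count] at h1 h2
    simp only [sumAggregation, h1, h2, ← sub_smul]
    simp
  · exact fun i hi => if_neg hi
  · intro i hi
    obtain ⟨p, hp, rfl⟩ := Finset.mem_map.1 hi
    rw [hX, hmP' p hp]
    omega
  · intro i hi
    obtain ⟨p, hp, rfl⟩ := Finset.mem_map.1 hi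
    rw [hX', hmP' p hp]
    omega
  · intro i h1 h2
    have hi : i ∉ Set.range g := by
      rintro ⟨p, rfl⟩
      by_cases hp : p ∈ P
      · exact h1 (Finset.mem_map_of_mem g hp)
      · exact h2 (Finset.mem_map_of_mem g (Finset.mem_compl.2 hp))
    right
    rw [gridDataset_inGroup_of_notMem e g t _ hi, gridDataset_inGroup_of_notMem e g t _ hi]
  · rw [Finset.card_map, hP]
  · rw [Finset.card_map, Finset.card_compl, hP, Fintype.card_fin]
    omega
  · intro i hi
    obtain ⟨p, hp, rfl⟩ := Finset.mem_map.1 hi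
    rw [hX, hmP p hp]

/-! ### Exactness: privacy forces each of the three terms below δ -/

theorem tendsto_Phi_sub_natCast_div (c : ℝ) {σ : ℝ} (hσ : 0 < σ) :
    Filter.Tendsto (fun n : ℕ => Phi ((c - n) / σ)) Filter.atTop (nhds 0) := by
  refine (tendsto_cdf_atBot _).comp (Filter.Tendsto.atBot_div_const hσ ?_)
  simp only [sub_eq_add_neg]
  exact Filter.tendsto_atBot_add_const_left _ _
    (Filter.tendsto_neg_atTop_atBot.comp tendsto_natCast_atTop_atTop)

open Matrix in
theorem gshmDelta_le_of_isDP (hCu : 1 ≤ Cu) (e : ℕ ↪ U) (g : Fin Cu ↪ ι) (t : T)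
    {τ : ℕ} (hτ : 1 ≤ τ) {τs σ : ℝ} (hσ : 0 < σ)
    {Sig : Matrix (Fin k) (Fin k) ℝ} (hSig : Sig.PosDef) {μo : ℝ} {w : EuclideanSpace ℝ (Fin k)}
    (hw : w.ofLp ⬝ᵥ Sig⁻¹ *ᵥ w.ofLp = μo ^ 2) {ε δ : ℝ}
    (hDP : IsDP (Neighbors (U := U) (ι := ι) (T := T) (Cu := Cu))
      (gshm (sumAggregation U ι T w) τ τs σ Sig) ε δ) :
    gshmDelta Cu hCu τ τs σ μo ε ≤ δ := by
  classical
  set A := sumAggregation U ι T w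
  have hβ := Phi_pos ((τs - τ) / σ)
  have hsplit : ∀ p ∈ splits Cu, p.1 + p.2 = Cu ∧ 0 < p.1 := by
    intro p hp
    rw [splits, Finset.mem_filter] at hp
    exact ⟨Finset.HasAntidiagonal.mem_antidiagonal.1 hp.1, hp.2⟩
  -- The test loses at most a union bound over the `a` rows that may be hidden, and this vanishes as
  -- their common count `n` grows.
  have hlim : ∀ (a : ℕ) (C x : ℝ), (∀ n : ℕ, τ ≤ n → x ≤ δ + C * (a * Phi ((τs - n) / σ))) →
      x ≤ δ := by
    intro a C x hx
    have h1 : Filter.Tendsto (fun n : ℕ => δ + C * (a * Phi ((τs - n) / σ))) Filter.atTop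
        (nhds (δ + C * (a * 0))) :=
      (((tendsto_Phi_sub_natCast_div τs hσ).const_mul _).const_mul _).const_add _
    rw [mul_zero, mul_zero, add_zero] at h1
    exact ge_of_tendsto h1 (Filter.eventually_atTop.2 ⟨τ, hx⟩)
  have hq : ∀ Jp : Finset ι, Real.sqrt (∑ i ∈ Jp, Real.toNNReal (rowSq σ Sig
      (if i ∈ Jp then (1, w) else 0)) : ℝ≥0) = muPlus σ μo Jp.card := by
    intro Jp
    have : ∑ i ∈ Jp, Real.toNNReal (rowSq σ Sig (if i ∈ Jp then (1, w) else 0)) =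
        ∑ i ∈ Jp, Real.toNNReal (1 / σ ^ 2 + μo ^ 2) :=
      Finset.sum_congr rfl fun i hi => by rw [if_pos hi, rowSq, hw, one_pow]
    rw [this, Finset.sum_const, muPlus, NNReal.coe_nsmul, Real.coe_toNNReal _ (by positivity),
      nsmul_eq_mul]
    congr 1
    ring
  -- The shift raises the count noise by 1, so low noise is no likelier under the shifted law and
  -- the same union bound applies.
  have hshift : ∀ (Jp : Finset ι) (c : ℝ), ((noiseLaw ι σ Sig).map
      (· + fun i => if i ∈ Jp then ((1 : ℝ), w) else 0)).real {z | ∃ i ∈ Jp, (z i).1 < c} ≤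
      (noiseLaw ι σ Sig).real {z | ∃ i ∈ Jp, (z i).1 < c} := by
    intro Jp c
    have hm : MeasurableSet {z : ι → ℝ × EuclideanSpace ℝ (Fin k) | ∃ i ∈ Jp, (z i).1 < c} := by
      have : {z : ι → ℝ × EuclideanSpace ℝ (Fin k) | ∃ i ∈ Jp, (z i).1 < c} =
          ⋃ i ∈ Jp, {z | (z i).1 < c} := by ext z; simp
      rw [this]
      exact Finset.measurableSet_biUnion _ fun i _ =>
        measurableSet_lt (by fun_prop) measurable_const
    rw [map_measureReal_apply (by fun_prop) hm]
    refine measureReal_mono ?_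
    rintro z ⟨i, hi, hz⟩
    refine ⟨i, hi, ?_⟩
    simp only [Pi.add_apply, hi, if_true, Prod.fst_add] at hz
    linarith
  have hne : ∀ Jp : Finset ι, 0 < Jp.card → ∑ i ∈ Jp, Real.toNNReal (rowSq σ Sig
      (if i ∈ Jp then (1, w) else 0)) ≠ 0 := by
    intro Jp hJ h0
    have := hq Jp
    rw [h0, NNReal.coe_zero, Real.sqrt_zero, muPlus] at this
    have : 0 < Real.sqrt (Jp.card / σ ^ 2 + Jp.card * μo ^ 2) := Real.sqrt_pos.2 (by positivity)
    linarith
  refine gshmDelta_le ?_ ?_ ?_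
  · obtain ⟨X, X', Jp, Je, hX, H, -, hJe, -⟩ :=
      exists_addition_sumAggregation e g t w hτ (zero_add Cu) le_rfl
    -- With all C_u groups in `Je`, the empty `S` gives the test that accepts when some row is
    -- visible.
    have := H.le_real_of_forall_le hσ Sig (hDP X' X (Or.symm hX)) MeasurableSet.empty
    rw [hJe] at this
    simpa using this
  · rintro ⟨a, b⟩ hp
    obtain ⟨hab, ha⟩ := hsplit _ hp
    dsimp only at hab ha ⊢
    refine hlim a (Phi ((τs - τ) / σ) ^ b) _ fun n hn => ?_
    obtain ⟨X, X', Jp, Je, hX, H, hJp, hJe, hcount⟩ :=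
      exists_addition_sumAggregation e g t w hτ hab hn
    have hLR := gaussLR_noiseLaw hσ hSig Jp _ H.shift_zero
    have hprob : IsProbabilityMeasure ((noiseLaw ι σ Sig).map
        (· + fun i => if i ∈ Jp then ((1 : ℝ), w) else 0)) :=
      Measure.isProbabilityMeasure_map (by fun_prop)
    have hreg := hLR.real_region_sub (hne Jp (by omega)) (eps2 τ τs σ ε b)
    have hdep := (dependsOnRows_region σ Sig Jp (fun i => if i ∈ Jp then ((1 : ℝ), w) else 0)
      (∑ i ∈ Jp, Real.toNNReal (rowSq σ Sig (if i ∈ Jp then (1, w) else 0)))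
      (eps2 τ τs σ ε b)).1
    rw [hq, hJp] at hreg
    have hmeas := hLR.measurableSet_region (eps2 τ τs σ ε b)
    generalize GaussLR.region _ _ _ = R at hreg hdep hmeas
    have hdp := H.le_real_of_forall_le hσ Sig (hDP X' X (Or.symm hX))
      (measurableSet_testSet A X Jp hmeas)
    rw [hJe] at hdp
    have h1 := measureReal_mono (μ := noiseLaw ι σ Sig)
      (preimage_testSet_subset (A := A) (τ := τ) (τs := τs) (X := X) hdep)
    have h2 := (measureReal_mono (μ := (noiseLaw ι σ Sig).map
      (· + fun i => if i ∈ Jp then ((1 : ℝ), w) else 0))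
      (subset_preimage_testSet_union (A := A) (τs := τs) hdep hn hcount)).trans
        (measureReal_union_le _ _)
    have h3 := (hshift Jp (τs - n)).trans (noiseLaw_real_exists_lt_le hσ Jp (τs - n))
    rw [hJp] at h3
    rw [← hreg, mul_sub, ← mul_assoc, pow_mul_exp_eps2]
    have h4 := mul_le_mul_of_nonneg_left (h2.trans (add_le_add_right h3 _)) (pow_pos hβ b).le
    have h5 := mul_le_mul_of_nonneg_left h1 (Real.exp_nonneg ε)
    rw [mul_add] at h4
    linarith
  · rintro ⟨a, b⟩ hp
    obtain ⟨hab, ha⟩ := hsplit _ hp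
    dsimp only at hab ha ⊢
    -- The hidden rows now cost mass of the unshifted law, which carries no weight β^b; hence the
    -- constant 1.
    refine hlim a 1 _ fun n hn => ?_
    obtain ⟨X, X', Jp, Je, hX, H, hJp, hJe, hcount⟩ :=
      exists_addition_sumAggregation e g t w hτ hab hn
    have hLR := gaussLR_noiseLaw hσ hSig Jp _ H.shift_zero
    have hprob : IsProbabilityMeasure ((noiseLaw ι σ Sig).map
        (· + fun i => if i ∈ Jp then ((1 : ℝ), w) else 0)) :=
      Measure.isProbabilityMeasure_map (by fun_prop)
    have hreg := hLR.symm.real_region_sub (hne Jp (by omega)) (eps3 τ τs σ ε b)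
    have hdep := (dependsOnRows_region σ Sig Jp (fun i => if i ∈ Jp then ((1 : ℝ), w) else 0)
      (∑ i ∈ Jp, Real.toNNReal (rowSq σ Sig (if i ∈ Jp then (1, w) else 0)))
      (eps3 τ τs σ ε b)).2
    rw [hq, hJp] at hreg
    have hmeas := hLR.symm.measurableSet_region (eps3 τ τs σ ε b)
    generalize GaussLR.region _ _ _ = R at hreg hdep hmeas
    have hdp := H.real_le_of_forall_le hσ Sig (hDP X X' hX)
      (measurableSet_testSet A X Jp hmeas)
    rw [hJe, ← mul_assoc, ← exp_eps3] at hdp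
    have h1 := measureReal_mono (μ := (noiseLaw ι σ Sig).map
      (· + fun i => if i ∈ Jp then ((1 : ℝ), w) else 0))
      (preimage_testSet_subset (A := A) (τ := τ) (τs := τs) (X := X) hdep)
    have h2 := (measureReal_mono (μ := noiseLaw ι σ Sig)
      (subset_preimage_testSet_union (A := A) (τs := τs) hdep hn hcount)).trans
        (measureReal_union_le _ _)
    have h3 := noiseLaw_real_exists_lt_le (Sig := Sig) hσ Jp (τs - n)
    rw [hJp] at h3
    have h5 := mul_le_mul_of_nonneg_left h1 (Real.exp_nonneg (eps3 τ τs σ ε b))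
    linarith

-- Rescaling any nonzero vector works; for `k = 0` the form vanishes, which is why μₒ must be 0
-- there.
open Matrix in
theorem exists_dotProduct_inv_mulVec_eq {Sig : Matrix (Fin k) (Fin k) ℝ} (hSig : Sig.PosDef)
    {μo : ℝ} (hk : k = 0 → μo = 0) :
    ∃ w : EuclideanSpace ℝ (Fin k), w.ofLp ⬝ᵥ Sig⁻¹ *ᵥ w.ofLp = μo ^ 2 := by
  rcases Nat.eq_zero_or_pos k with rfl | hpos
  · exact ⟨0, by simp [hk rfl]⟩
  · let v : Fin k → ℝ := fun _ => 1
    have hv : v ≠ 0 := fun h0 => one_ne_zero (congrFun h0 ⟨0, hpos⟩)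
    have hq : 0 < v ⬝ᵥ Sig⁻¹ *ᵥ v := by simpa using hSig.inv.dotProduct_mulVec_pos hv
    refine ⟨WithLp.toLp 2 ((μo / Real.sqrt (v ⬝ᵥ Sig⁻¹ *ᵥ v)) • v), ?_⟩
    rw [mulVec_smul, smul_dotProduct, dotProduct_smul, smul_eq_mul, smul_eq_mul, ← mul_assoc,
      div_mul_div_comm, Real.mul_self_sqrt hq.le, ← sq, div_mul_cancel₀ _ hq.ne']

theorem nonempty_fin_embedding {α : Type*} {n : ℕ} (h : (n : ℕ∞) ≤ ENat.card α) :
    Nonempty (Fin n ↪ α) := by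
  rcases finite_or_infinite α with hα | hα
  · have := Fintype.ofFinite α
    rw [ENat.card_eq_coe_fintype_card, Nat.cast_le] at h
    exact Function.Embedding.nonempty_of_card_le (by simpa using h)
  · exact ⟨Fin.valEmbedding.trans (Infinite.natEmbedding α)⟩

end GSHM

end

theorem mainTheorem1 {U ι T : Type*} [Countable ι] {k : ℕ}
    (Cu : ℕ) (hCu : 1 ≤ Cu) (τ : ℕ) (hτ : 1 ≤ τ) (τs : ℝ) (hτs : (τ : ℝ) < τs)
    (σ : ℝ) (hσ : 0 < σ) (Sig : Matrix (Fin k) (Fin k) ℝ) (hSig : Sig.PosDef)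
    (μo : ℝ) (hμo : 0 ≤ μo) :
    -- privacy, for every aggregation function
    (∀ A : GSHM.Aggregation U ι T k, IsLUB (GSHM.sensitivitySet Cu A Sig) (μo ^ 2) →
      ∀ ε δ : ℝ, 0 ≤ ε → δ ∈ Set.Icc (0 : ℝ) 1 →
        GSHM.gshmDelta Cu hCu τ τs σ μo ε ≤ δ →
        GSHM.IsDP (GSHM.Neighbors (U := U) (ι := ι) (T := T) (Cu := Cu))
          (GSHM.gshm A τ τs σ Sig) ε δ) ∧
    -- exactness
    (Infinite U → Nonempty T → (Cu : ℕ∞) ≤ ENat.card ι → (k = 0 → μo = 0) →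
      ∃ A : GSHM.Aggregation U ι T k, IsGreatest (GSHM.sensitivitySet Cu A Sig) (μo ^ 2) ∧
        ∀ ε δ : ℝ, 0 ≤ ε → δ ∈ Set.Icc (0 : ℝ) 1 →
          (GSHM.IsDP (GSHM.Neighbors (U := U) (ι := ι) (T := T) (Cu := Cu))
              (GSHM.gshm A τ τs σ Sig) ε δ ↔
            GSHM.gshmDelta Cu hCu τ τs σ μo ε ≤ δ)) := by
  refine ⟨fun A hA ε δ hε _ hD => GSHM.isDP_gshm hCu hσ hSig hA.1 hε hD, ?_⟩
  intro _ ⟨t⟩ hι hk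
  obtain ⟨g⟩ := GSHM.nonempty_fin_embedding hι
  obtain ⟨w, hw⟩ := GSHM.exists_dotProduct_inv_mulVec_eq hSig hk
  have hA := GSHM.isGreatest_sensitivitySet_sumAggregation hCu (Infinite.natEmbedding U) g t hw
  exact ⟨GSHM.sumAggregation U ι T w, hA, fun ε δ hε _ =>
    ⟨GSHM.gshmDelta_le_of_isDP hCu (Infinite.natEmbedding U) g t hτ hσ hSig hw,
      fun hD => GSHM.isDP_gshm hCu hσ hSig hA.2 hε hD⟩⟩
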